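/- Let $V$ be an $n$-dimensional ($n\ge 0$) Riemannian orbifold: a second countable Hausdorff space with an open cover $\{V_i\}$, connected open sets $U_i\subset\mathbb R^n$ with smooth Riemannian metrics $h_i$, finite groups $\Gamma_i$ of isometries of $(U_i,h_i)$ and open maps $q_i:U_i\to V_i$ inducing homeomorphisms $U_i/\Gamma_i\cong V_i$, such that whenever $q_i(x)=q_j(y)$ there is a change of charts, i.e. an isometry $\phi:W_i\to W_j$ between connected open neighbourhoods of $x$ in $U_i$ and of $y$ in $U_j$ with $q_j\phi=q_i$. *Singular objects.* $C^\infty(V)$ is the algebra of functions $f:V\to\mathbb R$ such that around each point there is a chart with $f q_i$ smooth. $\mathrm{Vect}(V)=\mathcal D^1(V)/\mathcal D^0(V)$ is identified with the operators $X$ on $C^\infty(V)$ that have the form $(Xf)q_i=\sum_j X^j\partial_j(fq_i)$ with smooth $X^j$ on every $U_i$ (the representatives killing constants). A one-form $\alpha\in\Omega^1(V)$ is a linear map $\mathrm{Vect}(V)\to C^\infty(V)$ with $\alpha(X)q_i=\sum_j\alpha_jX^j$ on every $U_i$, where the $\alpha_j\in C^\infty(U_i)$ do not depend on $X$. *Resolution.*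 Let $\tilde V$ be the manifold obtained from the bundles $\tilde U_i$ of orthonormal frames of $(U_i,h_i)$ by passing to the quotients $\tilde U_i/\Gamma_i$ and gluing them along the lifts of the changes of charts; let $p:\tilde V\to V$ be the projection, and let $\mathcal F$ be the foliation of $\tilde V$ whose leaves are the fibres of $p$, i.e. the (possibly disconnected) $O(n)$-orbits. *Foliated objects.* $C^\infty(\tilde V,\mathcal F)$ is the algebra of smooth functions that are constant on every leaf (on the whole fibre of $p$). $\Gamma(T\mathcal F)$ is the space of vector fields tangent to the leaves. $\mathrm{Vect}(\tilde V,\mathcal F)$ is the quotient by $\Gamma(T\mathcal F)$ of the adapted vector fields, i.e. of the vector fields $X$ with $[X,Y]\in\Gamma(T\mathcal F)$ for all $Y\in\Gamma(T\mathcal F)$ which map $C^\infty(\tilde V,\mathcal F)$ into itself. $\Omega^1(\tilde V,\mathcal F)$ consists of the one-forms $\theta$ with $i_Y\theta=i_Y d\theta=0$ for all $Y\in\Gamma(T\mathcal F)$ and $\theta(X)\in C^\infty(\tilde V,\mathcal F)$ for all adapted $X$. On either side, a torsion-free connection is an $\mathbb R$-bilinear map $\nabla$ on the module of vector fields with values in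 this module such that $\nabla_{fX}Y=f\nabla_XY$, $\nabla_X(fY)=(Xf)Y+f\nabla_XY$ and $\nabla_XY-\nabla_YX=[X,Y]$ for all functions $f$ in the corresponding algebra; $\mathcal C(V)$ and $\mathcal C(\tilde V,\mathcal F)$ are the sets of these. Two of them are projectively equivalent if $\nabla'_XY-\nabla_XY=\alpha(X)Y+\alpha(Y)X$ for some one-form $\alpha$ of the corresponding kind. **Proposition.** Put $p^*f=f\circ p$. There is a linear isomorphism $p_{\mathrm{Vect}}^*:\mathrm{Vect}(V)\to\mathrm{Vect}(\tilde V,\mathcal F)$ for which $p_{\mathrm{Vect}}^*X$ is the unique foliated vector field with $(p_{\mathrm{Vect}}^*X)(p^*f)=p^*(Xf)$ for all $f\in C^\infty(V)$; it respects brackets, and $p^*_{\mathrm{Vect}}(fX)=(p^*f)\,p^*_{\mathrm{Vect}}X$. For every $\nabla\in\mathcal C(V)$ the formula $$(p_{\mathcal C}^*\nabla)_XY=p_{\mathrm{Vect}}^*\bigl(\nabla_{p_{\mathrm{Vect}}^{*-1}X}\,p_{\mathrm{Vect}}^{*-1}Y\bigr),\qquad X,Y\in\mathrm{Vect}(\tilde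 V,\mathcal F),$$ defines a foliated torsion-free connection $p_{\mathcal C}^*\nabla\in\mathcal C(\tilde V,\mathcal F)$, and if $\nabla,\nabla'\in\mathcal C(V)$ are projectively equivalent, then so are $p_{\mathcal C}^*\nabla$ and $p_{\mathcal C}^*\nabla'$. More precisely, there is a map $p_\Omega^*:\Omega^1(V)\to\Omega^1(\tilde V,\mathcal F)$ with $(p_\Omega^*\alpha)(X)=p^*\bigl(\alpha(p_{\mathrm{Vect}}^{*-1}X)\bigr)$ for all $\alpha\in\Omega^1(V)$ and $X\in\mathrm{Vect}(\tilde V,\mathcal F)$, and if the difference $\nabla'-\nabla$ is given by $\alpha$, then the difference $p_{\mathcal C}^*\nabla'-p_{\mathcal C}^*\nabla$ is given by $p_\Omega^*\alpha$. -/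

import Mathlib

open scoped ContDiff

noncomputable section

/-! ## Torsion-free connections on a module of vector fields -/

/-- A torsion-free connection on a module `L` of vector fields over an algebra `A` of functions,
where `ρ` is the action of vector fields on functions and `⁅·, ·⁆` the bracket of vector fields. -/
structure TorsionFreeConnection (A L : Type*) [CommRing A] [Algebra ℝ A] [AddCommGroup L]
    [Module ℝ L] [Module A L] [Bracket L L] (ρ : L → A → A) where
  toFun : L →ₗ[ℝ] L →ₗ[ℝ] L
  smul_left : ∀ (f : A) (X Y : L), toFun (f • X) Y = f • toFun X Y
  leibniz : ∀ (f : A) (X Y : L), toFun X (f • Y) = ρ X f • Y + f • toFun X Y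
  torsion_free : ∀ X Y : L, toFun X Y - toFun Y X = ⁅X, Y⁆

/-- `∇'_X Y - ∇_X Y = α(X) Y + α(Y) X` for all vector fields `X`, `Y`. -/
def TorsionFreeConnection.DiffersBy {A L : Type*} [CommRing A] [Algebra ℝ A] [AddCommGroup L]
    [Module ℝ L] [Module A L] [Bracket L L] {ρ : L → A → A}
    (C C' : TorsionFreeConnection A L ρ) (α : L → A) : Prop :=
  ∀ X Y : L, C'.toFun X Y - C.toFun X Y = α X • Y + α Y • X

/-! ## Algebras of smooth functions -/

/-- The functions in a given algebra `B` of smooth functions on `M`, as a type. -/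
def SmoothFun {M : Type*} (B : Subalgebra ℝ (M → ℝ)) : Type _ := B

namespace SmoothFun

variable {M : Type*} {B : Subalgebra ℝ (M → ℝ)}

instance : CommRing (SmoothFun B) := inferInstanceAs (CommRing B)
instance : Algebra ℝ (SmoothFun B) := inferInstanceAs (Algebra ℝ B)
instance : CoeFun (SmoothFun B) (fun _ => M → ℝ) := ⟨Subtype.val⟩

@[ext]
theorem ext {f g : SmoothFun B} (h : ∀ x, f x = g x) : f = g := Subtype.ext (funext h)

@[simp] theorem add_apply (f g : SmoothFun B) (x : M) : (f + g) x = f x + g x := rfl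
@[simp] theorem sub_apply (f g : SmoothFun B) (x : M) : (f - g) x = f x - g x := rfl
@[simp] theorem mul_apply (f g : SmoothFun B) (x : M) : (f * g) x = f x * g x := rfl
@[simp] theorem zero_apply (x : M) : (0 : SmoothFun B) x = 0 := rfl
@[simp] theorem one_apply (x : M) : (1 : SmoothFun B) x = 1 := rfl

end SmoothFun

/-! ## Foliated objects

A foliated manifold `M` enters through the algebra `B` of its smooth functions and the equivalence
relation `F` on `M` whose classes are the leaves.  Vector fields are the derivations of the algebra
of smooth functions, and one-forms are the linear maps, over this algebra, from vector fields to
smooth functions. -/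

namespace Foliated

variable {M : Type*} (B : Subalgebra ℝ (M → ℝ)) (F : Setoid M)

/-- Vector fields on `M`. -/
abbrev VF : Type _ := Derivation ℝ (SmoothFun B) (SmoothFun B)

/-- Smooth functions that are constant on every leaf. -/
def basic : Subalgebra ℝ (SmoothFun B) where
  carrier := {f | ∀ x y, F x y → f x = f y}
  mul_mem' {f g} hf hg x y h := by simp [hf x y h, hg x y h]
  add_mem' {f g} hf hg x y h := by simp [hf x y h, hg x y h]
  algebraMap_mem' r x y _ := rfl

/-- The algebra of foliated functions. -/
def Fun : Type _ := basic B F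

instance : CommRing (Fun B F) := inferInstanceAs (CommRing (basic B F))
instance : Algebra ℝ (Fun B F) := inferInstanceAs (Algebra ℝ (basic B F))
instance : Algebra (Fun B F) (SmoothFun B) := inferInstanceAs (Algebra (basic B F) (SmoothFun B))
instance : IsScalarTower ℝ (Fun B F) (SmoothFun B) :=
  inferInstanceAs (IsScalarTower ℝ (basic B F) (SmoothFun B))

/-- `Γ(TF)`: the vector fields tangent to every leaf, i.e. those that preserve, for every leaf,
the ideal of the smooth functions vanishing on this leaf. -/
def tangent : Submodule (SmoothFun B) (VF B) where
  carrier := {Y | ∀ x, ∀ G : SmoothFun B, (∀ y, F x y → G y = 0) → ∀ y, F x y → Y G y = 0}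
  zero_mem' x G _ y _ := rfl
  add_mem' {Y Z} hY hZ x G hG y hy := by
    simp [hY x G hG y hy, hZ x G hG y hy]
  smul_mem' b Y hY x G hG y hy := by
    simp [hY x G hG y hy]

variable {B F}

theorem tangent_apply_eq_zero {Y : VF B} (hY : Y ∈ tangent B F) {f : SmoothFun B}
    (hf : f ∈ basic B F) : Y f = 0 := by
  ext x
  have h := hY x (f - algebraMap ℝ (SmoothFun B) (f x))
    (fun y hy => by
      change f y - f x = 0
      rw [hf x y hy, sub_self]) x (F.refl x)
  rw [map_sub, Derivation.map_algebraMap, sub_zero] at h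
  exact h

theorem tangent_lie {X Y : VF B} (hX : X ∈ tangent B F) (hY : Y ∈ tangent B F) :
    ⁅X, Y⁆ ∈ tangent B F := by
  intro x G hG y hy
  rw [Derivation.commutator_apply, SmoothFun.sub_apply,
    hX x (Y G) (hY x G hG) y hy, hY x (X G) (hX x G hG) y hy, sub_self]

variable (B F)

/-- Adapted vector fields: the vector fields `X` with `[X, Y] ∈ Γ(TF)` for all `Y ∈ Γ(TF)` that act
on the foliated functions.  (The second condition follows from the first one if the leaves
are connected; it is needed for leaves with several components.) -/
def adapted : Submodule (Fun B F) (VF B) where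
  carrier := {X | (∀ Y ∈ tangent B F, ⁅X, Y⁆ ∈ tangent B F) ∧ ∀ f ∈ basic B F, X f ∈ basic B F}
  zero_mem' := ⟨fun Y _ => by rw [zero_lie]; exact zero_mem _, fun f _ => zero_mem _⟩
  add_mem' {X Z} hX hZ := ⟨fun Y hY => by
      rw [add_lie]; exact add_mem (hX.1 Y hY) (hZ.1 Y hY),
    fun f hf => add_mem (hX.2 f hf) (hZ.2 f hf)⟩
  smul_mem' b X hX := by
    refine ⟨fun Y hY => ?_, fun f hf => mul_mem b.2 (hX.2 f hf)⟩
    have h : ⁅b • X, Y⁆ = b.1 • ⁅X, Y⁆ := by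
      ext1 G
      have hb : Y b.1 = 0 := tangent_apply_eq_zero hY b.2
      rw [Derivation.commutator_apply]
      change b.1 * X (Y G) - Y (b.1 * X G) = b.1 * (X (Y G) - Y (X G))
      rw [Derivation.leibniz, hb, smul_eq_mul, smul_zero, add_zero, mul_sub]
    rw [h]
    exact Submodule.smul_mem _ _ (hX.1 Y hY)

variable {B F}

theorem tangent_le_adapted {Y : VF B} (hY : Y ∈ tangent B F) : Y ∈ adapted B F :=
  ⟨fun _ hZ => tangent_lie hY hZ, fun f hf => by
    rw [tangent_apply_eq_zero hY hf]; exact zero_mem _⟩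

theorem adapted_lie {X Y : VF B} (hX : X ∈ adapted B F) (hY : Y ∈ adapted B F) :
    ⁅X, Y⁆ ∈ adapted B F := by
  refine ⟨fun Z hZ => ?_, fun f hf => ?_⟩
  · rw [lie_lie]
    exact sub_mem (hX.1 _ (hY.1 Z hZ)) (hY.1 _ (hX.1 Z hZ))
  · rw [Derivation.commutator_apply]
    exact sub_mem (hX.2 _ (hY.2 f hf)) (hY.2 _ (hX.2 f hf))

variable (B F)

/-- `Γ(TF)` as a submodule of the adapted vector fields. -/
def tangentInAdapted : Submodule (Fun B F) (adapted B F) :=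
  ((tangent B F).restrictScalars (Fun B F)).comap (adapted B F).subtype

/-- Foliated vector fields: adapted vector fields modulo `Γ(TF)`. -/
abbrev Vect : Type _ := adapted B F ⧸ tangentInAdapted B F

variable {B F}

/-- The derivation of the algebra of foliated functions given by an adapted vector field. -/
def adaptedAct : adapted B F →ₗ[Fun B F] Derivation ℝ (Fun B F) (Fun B F) where
  toFun X := Derivation.mk'
    { toFun := fun f => ⟨X.1 f.1, X.2.2 f.1 f.2⟩
      map_add' := fun f g => Subtype.ext (map_add X.1 f.1 g.1)
      map_smul' := fun r f => Subtype.ext (X.1.map_smul r f.1) }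
    (fun f g => Subtype.ext (X.1.leibniz f.1 g.1))
  map_add' _ _ := rfl
  map_smul' _ _ := rfl

/-- The action of foliated vector fields on foliated functions, `[X] f = X f`. -/
def Vect.act : Vect B F →ₗ[Fun B F] Derivation ℝ (Fun B F) (Fun B F) :=
  (tangentInAdapted B F).liftQ adaptedAct fun X hX => by
    ext1 f
    exact Subtype.ext (tangent_apply_eq_zero (f := f.1) hX f.2)

/-- The bracket of foliated vector fields, `[[X], [Y]] = [[X, Y]]`. -/
instance : Bracket (Vect B F) (Vect B F) where
  bracket := Quotient.map₂ (fun X Y => ⟨⁅X.1, Y.1⁆, adapted_lie X.2 Y.2⟩) (by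
    intro X X' hX Y Y' hY
    have hX' : X.1 - X'.1 ∈ tangent B F :=
      (Submodule.quotientRel_def (tangentInAdapted B F)).1 hX
    have hY' : Y.1 - Y'.1 ∈ tangent B F :=
      (Submodule.quotientRel_def (tangentInAdapted B F)).1 hY
    refine (Submodule.quotientRel_def (tangentInAdapted B F)).2 ?_
    change ⁅X.1, Y.1⁆ - ⁅X'.1, Y'.1⁆ ∈ tangent B F
    have h : ⁅X.1, Y.1⁆ - ⁅X'.1, Y'.1⁆ = ⁅X.1, Y.1 - Y'.1⁆ - ⁅Y'.1, X.1 - X'.1⁆ := by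
      rw [lie_sub, lie_sub, ← lie_skew Y'.1 X.1, ← lie_skew Y'.1 X'.1]
      abel
    rw [h]
    exact sub_mem (X.2.1 _ hY') (Y'.2.1 _ hX'))

variable (B F)

/-- Foliated one-forms: the one-forms `θ` with `i_Y θ = i_Y dθ = 0` for all `Y ∈ Γ(TF)`, where
`dθ(Y, X) = Y(θ(X)) - X(θ(Y)) - θ([Y, X])`, whose values on adapted vector fields are foliated
functions.  (The last condition follows from the others if the leaves are connected.) -/
structure Form where
  toFun : VF B →ₗ[SmoothFun B] SmoothFun B
  contract : ∀ Y ∈ tangent B F, toFun Y = 0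
  contract_d : ∀ Y ∈ tangent B F, ∀ X : VF B, Y (toFun X) - X (toFun Y) - toFun ⁅Y, X⁆ = 0
  map_adapted : ∀ X ∈ adapted B F, toFun X ∈ basic B F

variable {B F}

/-- The foliated function `θ([X]) = θ(X)`. -/
def Form.eval (θ : Form B F) : Vect B F →ₗ[Fun B F] Fun B F :=
  (tangentInAdapted B F).liftQ
    { toFun := fun X => ⟨θ.toFun X.1, θ.map_adapted X.1 X.2⟩
      map_add' := fun X Y => Subtype.ext (map_add θ.toFun X.1 Y.1)
      map_smul' := fun b X => Subtype.ext (map_smul θ.toFun b.1 X.1) }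
    fun X hX => Subtype.ext (θ.contract X.1 hX)

variable (B F)

/-- Foliated torsion-free connections. -/
abbrev Connection : Type _ :=
  TorsionFreeConnection (Fun B F) (Vect B F) (fun X f => Vect.act X f)

variable {B F}

/-- Projective equivalence of foliated torsion-free connections. -/
def ProjEquiv (C C' : Connection B F) : Prop := ∃ θ : Form B F, C.DiffersBy C' θ.eval

end Foliated

/-! ## Riemannian orbifolds -/

/-- `φ` restricts to an isometry from `(W, g)` onto `(W', g')`. -/
structure IsIsometryOn {n : ℕ}
    (g g' : EuclideanSpace ℝ (Fin n) →
      EuclideanSpace ℝ (Fin n) →L[ℝ] EuclideanSpace ℝ (Fin n) →L[ℝ] ℝ)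
    (φ : EuclideanSpace ℝ (Fin n) → EuclideanSpace ℝ (Fin n))
    (W W' : Set (EuclideanSpace ℝ (Fin n))) : Prop where
  contDiffOn : ContDiffOn ℝ ∞ φ W
  bijOn : Set.BijOn φ W W'
  metric : ∀ x ∈ W, ∀ v w, g' (φ x) (fderiv ℝ φ x v) (fderiv ℝ φ x w) = g x v w

/-- `φ : W → W'` is a change of charts from `(U, g, q)` to `(U', g', q')`: an isometry between
connected open subsets of `U` and `U'` with `q' φ = q` on `W`. -/
structure IsChartChange {n : ℕ} {V : Type*} (U U' : Set (EuclideanSpace ℝ (Fin n)))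
    (g g' : EuclideanSpace ℝ (Fin n) →
      EuclideanSpace ℝ (Fin n) →L[ℝ] EuclideanSpace ℝ (Fin n) →L[ℝ] ℝ)
    (q q' : EuclideanSpace ℝ (Fin n) → V)
    (φ : EuclideanSpace ℝ (Fin n) → EuclideanSpace ℝ (Fin n))
    (W W' : Set (EuclideanSpace ℝ (Fin n))) : Prop where
  subset : W ⊆ U
  subset' : W' ⊆ U'
  isOpen : IsOpen W
  isOpen' : IsOpen W'
  isConnected : IsConnected W
  isConnected' : IsConnected W'
  isometry : IsIsometryOn g g' φ W W'
  comp_eq : ∀ x ∈ W, q' (φ x) = q x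

/-- An `n`-dimensional Riemannian orbifold structure on the space `V`.  Only the restrictions of
`g i` and `q i` to `U i` matter; the permutations of `U i` that belong to the group `Γ i` are
extended by the identity outside `U i`. The open sets of the cover are the images `q i '' U i`. -/
structure RiemannianOrbifold (n : ℕ) (V : Type*) [TopologicalSpace V] where
  ι : Type*
  U : ι → Set (EuclideanSpace ℝ (Fin n))
  isOpen_U : ∀ i, IsOpen (U i)
  isConnected_U : ∀ i, IsConnected (U i)
  g : ι → EuclideanSpace ℝ (Fin n) →
    EuclideanSpace ℝ (Fin n) →L[ℝ] EuclideanSpace ℝ (Fin n) →L[ℝ] ℝ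
  contDiffOn_g : ∀ i, ContDiffOn ℝ ∞ (g i) (U i)
  g_symm : ∀ i, ∀ x ∈ U i, ∀ v w, g i x v w = g i x w v
  g_pos : ∀ i, ∀ x ∈ U i, ∀ v, v ≠ 0 → 0 < g i x v v
  Γ : ι → Subgroup (Equiv.Perm (EuclideanSpace ℝ (Fin n)))
  finite_Γ : ∀ i, Finite (Γ i)
  Γ_eq_self : ∀ i, ∀ γ ∈ Γ i, ∀ x ∉ U i, γ x = x
  Γ_isometry : ∀ i, ∀ γ ∈ Γ i, IsIsometryOn (g i) (g i) γ (U i) (U i)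
  q : ι → EuclideanSpace ℝ (Fin n) → V
  continuousOn_q : ∀ i, ContinuousOn (q i) (U i)
  isOpen_image_q : ∀ i, ∀ s ⊆ U i, IsOpen s → IsOpen (q i '' s)
  q_eq_iff : ∀ i, ∀ x ∈ U i, ∀ y ∈ U i, q i x = q i y ↔ ∃ γ ∈ Γ i, γ x = y
  cover : ∀ v, ∃ i, v ∈ q i '' U i
  exists_change : ∀ i j, ∀ x ∈ U i, ∀ y ∈ U j, q i x = q j y →
    ∃ φ W W', IsChartChange (U i) (U j) (g i) (g j) (q i) (q j) φ W W' ∧ x ∈ W ∧ y ∈ W'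

namespace RiemannianOrbifold

variable {n : ℕ} {V : Type*} [TopologicalSpace V] (O : RiemannianOrbifold n V)

/-- `f` is smooth: around every point there is a chart in which `f` is smooth. -/
def IsSmooth (f : V → ℝ) : Prop :=
  ∀ v, ∃ i, v ∈ O.q i '' O.U i ∧ ContDiffOn ℝ ∞ (fun x => f (O.q i x)) (O.U i)

variable {O} in
theorem IsSmooth.contDiffOn {f : V → ℝ} (hf : O.IsSmooth f) (j : O.ι) :
    ContDiffOn ℝ ∞ (fun x => f (O.q j x)) (O.U j) := by
  intro y hy
  obtain ⟨i, ⟨x, hx, hxy⟩, hi⟩ := hf (O.q j y)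
  obtain ⟨φ, W, W', hφ, hyW, -⟩ := O.exists_change j i y hy x hx hxy.symm
  have hmaps : Set.MapsTo φ W (O.U i) := fun z hz => hφ.subset' (hφ.isometry.bijOn.mapsTo hz)
  have h1 : ContDiffOn ℝ ∞ (fun z => f (O.q j z)) W :=
    (hi.comp hφ.isometry.contDiffOn hmaps).congr fun z hz => by
      simp only [Function.comp_apply, hφ.comp_eq z hz]
  exact (h1.contDiffAt (hφ.isOpen.mem_nhds hyW)).contDiffWithinAt

theorem isSmooth_of_forall {f : V → ℝ}
    (h : ∀ i, ContDiffOn ℝ ∞ (fun x => f (O.q i x)) (O.U i)) : O.IsSmooth f :=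
  fun v => (O.cover v).imp fun i hi => ⟨hi, h i⟩

/-- The algebra of smooth functions of the orbifold. -/
def smooth : Subalgebra ℝ (V → ℝ) where
  carrier := {f | O.IsSmooth f}
  mul_mem' hf hg := O.isSmooth_of_forall fun i => (hf.contDiffOn i).mul (hg.contDiffOn i)
  add_mem' hf hg := O.isSmooth_of_forall fun i => (hf.contDiffOn i).add (hg.contDiffOn i)
  algebraMap_mem' _ := O.isSmooth_of_forall fun _ => contDiffOn_const

/-- `C^∞(V)`. -/
abbrev Fun : Type _ := SmoothFun O.smooth

/-- On the chart domain `U i` the operator `X` is the vector field `ξ` with smooth components: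
`(X f) q_i = ∑ j, ξ^j ∂_j (f q_i)` for all `f ∈ C^∞(V)`. -/
def IsLocalForm (X : O.Fun → O.Fun) (i : O.ι)
    (ξ : EuclideanSpace ℝ (Fin n) → EuclideanSpace ℝ (Fin n)) : Prop :=
  ContDiffOn ℝ ∞ ξ (O.U i) ∧ ∀ (f : O.Fun), ∀ x ∈ O.U i,
    X f (O.q i x) = fderiv ℝ (fun y => f (O.q i y)) x (ξ x)

/-- The `C^∞(V)`-module `Vect(V) = D^1(V) / D^0(V)` of vector fields of the orbifold, where the
class of `D` is identified with its unique representative `D - D 1` that kills the constants: a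
derivation of `C^∞(V)` that has the form `∑ j, ξ^j ∂_j`, with smooth `ξ^j`, in all charts. -/
def vect : Submodule O.Fun (Derivation ℝ O.Fun O.Fun) where
  carrier := {X | ∀ i, ∃ ξ, O.IsLocalForm X i ξ}
  zero_mem' i := ⟨0, contDiffOn_const, fun f x _ => by simp⟩
  add_mem' {X Y} hX hY i := by
    obtain ⟨ξ, hξ, h1⟩ := hX i
    obtain ⟨η, hη, h2⟩ := hY i
    refine ⟨ξ + η, hξ.add hη, fun f x hx => ?_⟩
    rw [Pi.add_apply, map_add, ← h1 f x hx, ← h2 f x hx]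
    rfl
  smul_mem' b X hX i := by
    obtain ⟨ξ, hξ, h1⟩ := hX i
    refine ⟨fun x => b (O.q i x) • ξ x, (b.2.contDiffOn i).smul hξ, fun f x hx => ?_⟩
    rw [map_smul, ← h1 f x hx]
    rfl

/-- Every differential operator of order at most one is `f ↦ (D 1) f + X f` with a vector field
`X`. -/
theorem exists_mem_vect_of_order_one (D : O.Fun →ₗ[ℝ] O.Fun)
    (hD : ∀ i, ∃ c ξ, ContDiffOn ℝ ∞ c (O.U i) ∧ ContDiffOn ℝ ∞ ξ (O.U i) ∧
      ∀ (f : O.Fun), ∀ x ∈ O.U i, D f (O.q i x) = c x * f (O.q i x) +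
        fderiv ℝ (fun y => f (O.q i y)) x (ξ x)) :
    ∃ X ∈ O.vect, ∀ f, D f = D 1 * f + X f := by
  have key : ∀ i, ∃ ξ, ContDiffOn ℝ ∞ ξ (O.U i) ∧ ∀ (f : O.Fun), ∀ x ∈ O.U i,
      (D f - D 1 * f) (O.q i x) =
        fderiv ℝ (fun y => f (O.q i y)) x (ξ x) := by
    intro i
    obtain ⟨c, ξ, -, hξ, h⟩ := hD i
    refine ⟨ξ, hξ, fun f x hx => ?_⟩
    have h1 := h 1 x hx
    have h2 : fderiv ℝ (fun y => (1 : O.Fun) (O.q i y)) x = 0 := by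
      change fderiv ℝ (fun _ => (1 : ℝ)) x = 0
      simp
    rw [h2] at h1
    change D f (O.q i x) - D 1 (O.q i x) * f (O.q i x) = _
    rw [h f x hx, h1]
    change c x * f (O.q i x) + _ - (c x * 1 + 0) * f (O.q i x) = _
    ring
  refine ⟨Derivation.mk' (D - LinearMap.mulLeft ℝ (D 1)) fun f g => ?_, fun i => ?_, fun f => ?_⟩
  · ext v
    obtain ⟨i, x, hx, rfl⟩ := O.cover v
    obtain ⟨ξ, -, h⟩ := key i
    have hf := ((f.2.contDiffOn i).contDiffAt ((O.isOpen_U i).mem_nhds hx)).differentiableAt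
      (by simp)
    have hg := ((g.2.contDiffOn i).contDiffAt ((O.isOpen_U i).mem_nhds hx)).differentiableAt
      (by simp)
    change (D (f * g) - D 1 * (f * g)) (O.q i x) =
      f (O.q i x) * (D g - D 1 * g) (O.q i x) +
      g (O.q i x) * (D f - D 1 * f) (O.q i x)
    rw [h _ x hx, h _ x hx, h _ x hx]
    change fderiv ℝ (fun y => f (O.q i y) * g (O.q i y)) x (ξ x) = _
    rw [fderiv_fun_mul hf hg]
    simp
  · obtain ⟨ξ, hξ, h⟩ := key i
    exact ⟨ξ, hξ, h⟩
  · change D f = D 1 * f + (D f - D 1 * f)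
    ring

theorem vect_lie {X Y : Derivation ℝ O.Fun O.Fun} (hX : X ∈ O.vect) (hY : Y ∈ O.vect) :
    ⁅X, Y⁆ ∈ O.vect := by
  intro i
  obtain ⟨ξ, hξ, h1⟩ := hX i
  obtain ⟨η, hη, h2⟩ := hY i
  have hU := O.isOpen_U i
  have smooth_fderiv : ∀ ζ : EuclideanSpace ℝ (Fin n) → EuclideanSpace ℝ (Fin n),
      ContDiffOn ℝ ∞ ζ (O.U i) → ContDiffOn ℝ ∞ (fderiv ℝ ζ) (O.U i) :=
    fun ζ hζ => hζ.fderiv_of_isOpen hU (by simp)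
  refine ⟨fun x => fderiv ℝ η x (ξ x) - fderiv ℝ ξ x (η x),
    ((smooth_fderiv η hη).clm_apply hξ).sub ((smooth_fderiv ξ hξ).clm_apply hη),
    fun f x hx => ?_⟩
  have hn := hU.mem_nhds hx
  have hf : ContDiffAt ℝ ∞ (fun y => f (O.q i y)) x :=
    (f.2.contDiffOn i).contDiffAt hn
  have hdf : DifferentiableAt ℝ (fderiv ℝ (fun y => f (O.q i y))) x :=
    ((hf.fderiv_right (m := ∞) (by simp)).differentiableAt (by simp))
  have second : ∀ (A Z : Derivation ℝ O.Fun O.Fun)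
      (α ζ : EuclideanSpace ℝ (Fin n) → EuclideanSpace ℝ (Fin n)),
      O.IsLocalForm A i α → O.IsLocalForm Z i ζ →
      A (Z f) (O.q i x) =
        fderiv ℝ (fderiv ℝ (fun y => f (O.q i y))) x (α x) (ζ x) +
        fderiv ℝ (fun y => f (O.q i y)) x (fderiv ℝ ζ x (α x)) := by
    intro A Z α ζ hA hZ
    have hζ : DifferentiableAt ℝ ζ x := (hZ.1.contDiffAt hn).differentiableAt (by simp)
    have e : (fun y => Z f (O.q i y)) =ᶠ[nhds x]
        fun y => fderiv ℝ (fun y => f (O.q i y)) y (ζ y) := by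
      filter_upwards [hn] with y hy using hZ.2 f y hy
    rw [hA.2 _ x hx, e.fderiv_eq, fderiv_clm_apply hdf hζ]
    simp [add_comm]
  have hsymm : IsSymmSndFDerivAt ℝ (fun y => f (O.q i y)) x :=
    hf.isSymmSndFDerivAt (by
      rw [minSmoothness_of_isRCLikeNormedField]
      exact WithTop.coe_le_coe.2 (le_top : (2 : ℕ∞) ≤ ⊤))
  rw [Derivation.commutator_apply]
  change X (Y f) (O.q i x) - Y (X f) (O.q i x) = _
  rw [second X Y ξ η ⟨hξ, h1⟩ ⟨hη, h2⟩, second Y X η ξ ⟨hη, h2⟩ ⟨hξ, h1⟩,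
    hsymm.eq (ξ x) (η x), map_sub]
  ring

/-- `Vect(V)`. -/
abbrev Vect : Type _ := O.vect

/-- The bracket of vector fields of the orbifold, the commutator of operators. -/
instance : Bracket O.Vect O.Vect where
  bracket X Y := ⟨⁅X.1, Y.1⁆, O.vect_lie X.2 Y.2⟩

/-- Differential one-forms of the orbifold. -/
structure Form where
  toFun : O.Vect →ₗ[ℝ] O.Fun
  local_form : ∀ i, ∃ a : EuclideanSpace ℝ (Fin n) → EuclideanSpace ℝ (Fin n) →L[ℝ] ℝ,
    ContDiffOn ℝ ∞ a (O.U i) ∧ ∀ (X : O.Vect) (ξ), O.IsLocalForm X.1 i ξ →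
      ∀ x ∈ O.U i, toFun X (O.q i x) = a x (ξ x)

/-- Torsion-free connections of the orbifold. -/
abbrev Connection : Type _ := TorsionFreeConnection O.Fun O.Vect (fun X f => X.1 f)

variable {O} in
/-- Projective equivalence of torsion-free connections of the orbifold. -/
def ProjEquiv (C C' : O.Connection) : Prop := ∃ α : O.Form, C.DiffersBy C' α.toFun

/-! ## The foliated resolution -/

/-- The bundle of orthonormal frames `(x, (e_1, …, e_n))` of `(U i, g i)`. -/
def frames (i : O.ι) :
    Set (EuclideanSpace ℝ (Fin n) × (Fin n → EuclideanSpace ℝ (Fin n))) :=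
  {z | z.1 ∈ O.U i ∧ ∀ a b, O.g i z.1 (z.2 a) (z.2 b) = if a = b then 1 else 0}

/-- The lift of some change of charts maps the frame `z` to the frame `w`.  The elements of `Γ i`
are changes of charts from `U i` to itself, so that this relation comprises both the action of
`Γ i` on the frames of `U i` and the gluing of different charts. -/
def FrameRel (z w : Σ i, O.frames i) : Prop :=
  ∃ φ W W', IsChartChange (O.U z.1) (O.U w.1) (O.g z.1) (O.g w.1) (O.q z.1) (O.q w.1) φ W W' ∧
    z.2.1.1 ∈ W ∧ φ z.2.1.1 = w.2.1.1 ∧ ∀ a, fderiv ℝ φ z.2.1.1 (z.2.1.2 a) = w.2.1.2 a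

/-- The resolution of the orbifold: the quotients of the frame bundles of the charts by the
groups `Γ i`, glued along the changes of charts. -/
def Res : Type _ := Quot O.FrameRel

/-- The projection of the resolution onto the orbifold. -/
def proj : O.Res → V :=
  Quot.lift (fun z => O.q z.1 z.2.1.1) (by
    rintro z w ⟨φ, W, W', h, hz, hw, -⟩
    rw [← h.comp_eq _ hz, hw])

/-- The smooth structure of the resolution, given by its algebra of smooth functions: `G` is
smooth if it is smooth as a function on the frame bundles of the charts, which are submanifolds
of a Euclidean space and locally diffeomorphic to the resolution. -/
def resSmooth : Subalgebra ℝ (O.Res → ℝ) where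
  carrier := {G | ∀ i, ∃ H : EuclideanSpace ℝ (Fin n) × (Fin n → EuclideanSpace ℝ (Fin n)) → ℝ,
    ContDiffOn ℝ ∞ H (O.frames i) ∧ ∀ z : O.frames i, G (Quot.mk _ ⟨i, z⟩) = H z}
  mul_mem' {G G'} hG hG' i := by
    obtain ⟨H, h, e⟩ := hG i
    obtain ⟨H', h', e'⟩ := hG' i
    exact ⟨fun z => H z * H' z, h.mul h', fun z => by exact congrArg₂ (· * ·) (e z) (e' z)⟩
  add_mem' {G G'} hG hG' i := by
    obtain ⟨H, h, e⟩ := hG i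
    obtain ⟨H', h', e'⟩ := hG' i
    exact ⟨fun z => H z + H' z, h.add h', fun z => by exact congrArg₂ (· + ·) (e z) (e' z)⟩
  algebraMap_mem' r i := ⟨fun _ => r, contDiffOn_const, fun _ => rfl⟩

/-- The foliation of the resolution: its leaves are the fibres of the projection, which are the
orbits of the orthogonal group acting on the orthonormal frames. -/
def fol : Setoid O.Res := Setoid.ker O.proj

/-- Foliated functions of the resolution. -/
abbrev FolFun := Foliated.Fun O.resSmooth O.fol

/-- Foliated vector fields of the resolution. -/
abbrev FolVect : Type _ := Foliated.Vect O.resSmooth O.fol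

/-- Foliated one-forms of the resolution. -/
abbrev FolForm : Type _ := Foliated.Form O.resSmooth O.fol

/-- Foliated torsion-free connections of the resolution. -/
abbrev FolConnection : Type _ := Foliated.Connection O.resSmooth O.fol

/-- The pullback of functions along the projection. -/
def pullback (f : O.Fun) : O.FolFun :=
  ⟨⟨fun z => f (O.proj z), fun i => ⟨fun z => f (O.q i z.1),
    (f.2.contDiffOn i).comp contDiff_fst.contDiffOn fun _ hz => hz.1, fun _ => rfl⟩⟩,
    fun z w (h : O.proj z = O.proj w) => congrArg (f : V → ℝ) h⟩

end RiemannianOrbifold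

end

/-!
Everything is reduced to the comparison of a derivation of the smooth functions of the resolution
with its image under the differential of the projection `p`, which is a function on frames with
values in the tangent vectors of a chart.

*Charts.* An element of `Γ i` with a fixed point at which its derivative is the identity is trivial:
the mean of its iterates is an invariant local diffeomorphism, and `U i` is connected
(`Γ_eq_one_of_fderiv_eq_id`). Hence the points with trivial isotropy are dense
(`frequently_isRegular`), and changes of charts from `U i` to itself are elements of `Γ i`
(`Change.exists_eqOn_Γ`), so that `FrameRel` is already an equivalence relation
(`framePt_eq_framePt_iff`). Near a regular point all smooth functions extend to the orbifold
(`IsRegular.exists_fun_eventuallyEq`). Therefore a continuous vector field on a chart, or along its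
frame bundle, is determined by its action on `C^∞(V)`, although this can fail at a single singular
point.

*Derivations of the resolution.* `Γ i` acts freely on frames, so all smooth functions near a frame
extend to the resolution (`exists_resFun_eventuallyEq`). Derivations are therefore local, and by
Hadamard's lemma a derivation is given by a smooth vector field on the frame bundle of each chart
(`exists_isFrameForm`). Functions on the frame bundle are differentiated after extension along the
Gram–Schmidt retraction `retract`, which commutes with the lifts of isometries. It follows that
foliated functions are the pullbacks from `V` (`pullback_surjective`), that the vector fields
tangent to the leaves are those that kill the pullbacks (`mem_tangent_iff`), and that a foliated
vector field is determined by its action on the pullbacks (`act_injective`).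

*Vector fields.* A field `X` on `V` lifts without partitions of unity: in a chart where `X` is given
by `ξ`, the field `(x, A) ↦ (ξ(x), dξ_x A)` on bases is compatible with changes of charts
(`fderiv_frameLift_frameLift`), and `lift X` differentiates along it the functions extended by
`retract`. Conversely, an adapted field projected along a smooth orthonormal frame section gives a
field on `V` (`exists_vect_of_folVect`).

*One-forms.* The components of a one-form `α` are paired with the projection of a field `Z` of the
resolution (`formApply`). The result does not depend on the chart: at regular points every vector is
the value of a gradient field of `V`, and regular points are dense (`Change.coForm_baseForm`). For
`Y` tangent to the leaves, the projection of `[Y, Z]` is the derivative along `Y` of the projection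
of `Z` (`baseForm_lie`), which is the condition on `dθ`.

Connections are then transported along the isomorphism of the modules of vector fields.
-/

noncomputable section

open Set Filter
open scoped Topology

universe u

/-! ### Hadamard's lemma -/

theorem hasFDerivAt_integral_of_contDiff {H F : Type u} [NormedAddCommGroup H] [NormedSpace ℝ H]
    [FiniteDimensional ℝ H] [NormedAddCommGroup F] [NormedSpace ℝ F] [CompleteSpace F]
    {Φ : H × ℝ → F} (hΦ : ContDiff ℝ 1 Φ) (x₀ : H) :
    HasFDerivAt (fun x => ∫ t in (0 : ℝ)..1, Φ (x, t))
      (∫ t in (0 : ℝ)..1, (fderiv ℝ Φ (x₀, t)).comp (ContinuousLinearMap.inl ℝ H ℝ)) x₀ := by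
  have : ProperSpace H := FiniteDimensional.proper ℝ H
  have hc : Continuous fun p : H × ℝ =>
      (fderiv ℝ Φ p).comp (ContinuousLinearMap.inl ℝ H ℝ) :=
    (hΦ.continuous_fderiv (by simp)).clm_comp continuous_const
  obtain ⟨C, hC⟩ := ((isCompact_closedBall x₀ 1).prod
    (isCompact_Icc (a := (0 : ℝ)) (b := 1))).exists_bound_of_continuousOn hc.continuousOn
  refine (intervalIntegral.hasFDerivAt_integral_of_dominated_of_fderiv_le (bound := fun _ => C)
    (F := fun x t => Φ (x, t))
    (F' := fun x t => (fderiv ℝ Φ (x, t)).comp (ContinuousLinearMap.inl ℝ H ℝ))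
    (Metric.closedBall_mem_nhds x₀ one_pos) ?_ ?_ ?_ ?_ ?_ ?_)
  · exact Filter.Eventually.of_forall fun x =>
      (hΦ.continuous.comp (Continuous.prodMk_right x)).aestronglyMeasurable
  · exact (hΦ.continuous.comp (Continuous.prodMk_right x₀)).intervalIntegrable _ _
  · exact (hc.comp (Continuous.prodMk_right x₀)).aestronglyMeasurable
  · refine Filter.Eventually.of_forall fun t ht x hx => hC (x, t) ⟨hx, ?_⟩
    rw [Set.uIoc_of_le zero_le_one] at ht
    exact ⟨ht.1.le, ht.2⟩
  · simp
  · refine Filter.Eventually.of_forall fun t ht x hx => ?_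
    have h1 : HasFDerivAt Φ (fderiv ℝ Φ (x, t)) (x, t) :=
      (hΦ.differentiable (by simp) (x, t)).hasFDerivAt
    exact h1.comp x (hasFDerivAt_prodMk_left x t)

theorem contDiff_integral_of_contDiff {H F : Type u} [NormedAddCommGroup H] [NormedSpace ℝ H]
    [FiniteDimensional ℝ H] [NormedAddCommGroup F] [NormedSpace ℝ F] [CompleteSpace F]
    {Φ : H × ℝ → F} (hΦ : ContDiff ℝ ∞ Φ) :
    ContDiff ℝ ∞ (fun x => ∫ t in (0 : ℝ)..1, Φ (x, t)) := by
  refine contDiff_infty.2 fun k => ?_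
  induction k generalizing F with
  | zero =>
    exact contDiff_zero.2 (Differentiable.continuous (𝕜 := ℝ) fun x =>
      (hasFDerivAt_integral_of_contDiff (hΦ.of_le (by simp)) x).differentiableAt)
  | succ k ih =>
    refine (contDiff_succ_iff_hasFDerivAt (𝕜 := ℝ) (n := k)).2 ⟨_, ?_, fun x =>
      hasFDerivAt_integral_of_contDiff (hΦ.of_le (by simp)) x⟩
    exact ih (Φ := fun p => (fderiv ℝ Φ p).comp (ContinuousLinearMap.inl ℝ H ℝ))
      ((hΦ.fderiv_right (m := ∞) (by simp)).clm_comp contDiff_const)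

/-- Hadamard's lemma: `h(w) = h(z) + D(w)(w - z)` with a smooth family of linear forms `D`. -/
theorem exists_contDiff_eq_add_apply_sub {H : Type*} [NormedAddCommGroup H] [NormedSpace ℝ H]
    [FiniteDimensional ℝ H] {h : H → ℝ} (hh : ContDiff ℝ ∞ h) (z : H) :
    ∃ D : H → H →L[ℝ] ℝ, ContDiff ℝ ∞ D ∧ D z = fderiv ℝ h z ∧
      ∀ w, h w = h z + D w (w - z) := by
  have hs : ContDiff ℝ ∞ fun p : H × ℝ => fderiv ℝ h (z + p.2 • (p.1 - z)) :=
    (hh.fderiv_right (m := ∞) (by simp)).comp (by fun_prop)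
  refine ⟨fun w => ∫ t in (0 : ℝ)..1, fderiv ℝ h (z + t • (w - z)),
    contDiff_integral_of_contDiff hs, by simp, fun w => ?_⟩
  have hi : IntervalIntegrable (fun t : ℝ => fderiv ℝ h (z + t • (w - z)))
      MeasureTheory.volume 0 1 :=
    (hs.continuous.comp (Continuous.prodMk_right w)).intervalIntegrable _ _
  rw [ContinuousLinearMap.intervalIntegral_apply hi]
  have hd : ∀ t ∈ Set.uIcc (0 : ℝ) 1, HasDerivAt (fun t : ℝ => h (z + t • (w - z)))
      (fderiv ℝ h (z + t • (w - z)) (w - z)) t := fun t _ => by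
    have h1 := ((hh.differentiable (by simp)) (z + t • (w - z))).hasFDerivAt
    have h2 : HasDerivAt (fun t : ℝ => z + t • (w - z)) (w - z) t := by
      simpa using ((hasDerivAt_id t).smul_const (w - z)).const_add z
    exact h1.comp_hasDerivAt t h2
  rw [intervalIntegral.integral_eq_sub_of_hasDerivAt hd
    (((hs.continuous.comp (Continuous.prodMk_right w)).clm_apply
      continuous_const).intervalIntegrable _ _)]
  simp

/-! ### Gram–Schmidt orthonormalization for a bilinear form -/

section GramSchmidt

variable {n : ℕ} {E F : Type*} [NormedAddCommGroup E] [NormedSpace ℝ E]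
  [NormedAddCommGroup F] [NormedSpace ℝ F]

/-- The vector `u` divided by its length with respect to the bilinear form `B`. -/
def formNormalize (B : E →L[ℝ] E →L[ℝ] ℝ) (u : E) : E := (√(B u u))⁻¹ • u

/-- Gram–Schmidt orthonormalization of `A` with respect to the bilinear form `B`. -/
def formGramSchmidt (B : E →L[ℝ] E →L[ℝ] ℝ) (A : Fin n → E) (a : Fin n) : E :=
  formNormalize B (A a - ∑ b : Finset.Iio a,
    B (A a) (formGramSchmidt B A b) • formGramSchmidt B A b)
termination_by a
decreasing_by all_goals exact Fin.lt_def.1 (Finset.mem_Iio.1 b.2)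

/-- The component of `A a` orthogonal to its predecessors in the Gram–Schmidt process. -/
def formResidual (B : E →L[ℝ] E →L[ℝ] ℝ) (A : Fin n → E) (a : Fin n) : E :=
  A a - ∑ b ∈ Finset.Iio a, B (A a) (formGramSchmidt B A b) • formGramSchmidt B A b

theorem formGramSchmidt_eq (B : E →L[ℝ] E →L[ℝ] ℝ) (A : Fin n → E) (a : Fin n) :
    formGramSchmidt B A a = formNormalize B (formResidual B A a) := by
  rw [formGramSchmidt, formResidual, ← Finset.sum_coe_sort (Finset.Iio a)
    fun b => B (A a) (formGramSchmidt B A b) • formGramSchmidt B A b]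

/-- The family `e` is orthonormal for the bilinear form `B`. -/
def FormOrthonormal (B : E →L[ℝ] E →L[ℝ] ℝ) (e : Fin n → E) : Prop :=
  ∀ a b, B (e a) (e b) = if a = b then 1 else 0

/-- Gram–Schmidt orthonormalization commutes with linear isometries. -/
theorem formGramSchmidt_comp {B : E →L[ℝ] E →L[ℝ] ℝ} {B' : F →L[ℝ] F →L[ℝ] ℝ} {L : E →L[ℝ] F}
    (hL : ∀ v w, B' (L v) (L w) = B v w) (A : Fin n → E) (a : Fin n) :
    formGramSchmidt B' (fun b => L (A b)) a = L (formGramSchmidt B A a) := by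
  induction a using WellFoundedLT.induction with
  | ind a ih =>
    have h : formResidual B' (fun b => L (A b)) a = L (formResidual B A a) := by
      rw [formResidual, formResidual, map_sub, map_sum]
      congr 1
      refine Finset.sum_congr rfl fun b hb => ?_
      rw [ih b (Finset.mem_Iio.1 hb), hL, map_smul]
    rw [formGramSchmidt_eq, formGramSchmidt_eq, h, formNormalize, formNormalize, hL, map_smul]

theorem FormOrthonormal.formGramSchmidt {B : E →L[ℝ] E →L[ℝ] ℝ} {e : Fin n → E}
    (he : FormOrthonormal B e) : formGramSchmidt B e = e := by
  funext a
  induction a using WellFoundedLT.induction with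
  | ind a ih =>
    have h : formResidual B e a = e a := by
      rw [formResidual, Finset.sum_eq_zero, sub_zero]
      intro b hb
      rw [ih b (Finset.mem_Iio.1 hb), he, if_neg (Finset.mem_Iio.1 hb).ne', zero_smul]
    rw [formGramSchmidt_eq, h, formNormalize, he, if_pos rfl]
    simp

theorem formGramSchmidt_mem_span (B : E →L[ℝ] E →L[ℝ] ℝ) (A : Fin n → E) (a : Fin n) :
    formGramSchmidt B A a ∈ Submodule.span ℝ (A '' Set.Iic a) := by
  induction a using WellFoundedLT.induction with
  | ind a ih =>
    rw [formGramSchmidt_eq]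
    refine Submodule.smul_mem _ _ (sub_mem (Submodule.subset_span ⟨a, Set.mem_Iic.2 le_rfl, rfl⟩)
      (Submodule.sum_mem _ fun b hb => Submodule.smul_mem _ _ ?_))
    exact Submodule.span_mono (Set.image_mono (Set.Iic_subset_Iic.2 (Finset.mem_Iio.1 hb).le))
      (ih b (Finset.mem_Iio.1 hb))

theorem formResidual_ne_zero (B : E →L[ℝ] E →L[ℝ] ℝ) {A : Fin n → E}
    (hA : LinearIndependent ℝ A) (a : Fin n) : formResidual B A a ≠ 0 := by
  intro h
  refine hA.notMem_span_image (s := Set.Iio a) (x := a) (by simp) ?_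
  rw [formResidual, sub_eq_zero] at h
  rw [h]
  refine Submodule.sum_mem _ fun b hb => Submodule.smul_mem _ _ ?_
  exact Submodule.span_mono
    (Set.image_mono fun c hc => lt_of_le_of_lt hc (Finset.mem_Iio.1 hb))
    (formGramSchmidt_mem_span B A b)

theorem formOrthonormal_formGramSchmidt {B : E →L[ℝ] E →L[ℝ] ℝ} (hs : ∀ v w, B v w = B w v)
    (hp : ∀ v, v ≠ 0 → 0 < B v v) {A : Fin n → E} (hA : LinearIndependent ℝ A) :
    FormOrthonormal B (formGramSchmidt B A) := by
  have hdiag : ∀ a, B (formGramSchmidt B A a) (formGramSchmidt B A a) = 1 := fun a => by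
    have h := hp _ (formResidual_ne_zero B hA a)
    rw [formGramSchmidt_eq, formNormalize]
    simp only [map_smul, smul_eq_mul, smul_apply]
    have h2 := Real.sqrt_pos.2 h
    field_simp
    exact (Real.sq_sqrt h.le).symm
  have hlt : ∀ a b, b < a → B (formGramSchmidt B A a) (formGramSchmidt B A b) = 0 := by
    intro a
    induction a using WellFoundedLT.induction with
    | ind a ih =>
      intro b hb
      rw [formGramSchmidt_eq B A a, formNormalize]
      simp only [map_smul, smul_apply, smul_eq_mul]
      have h : B (formResidual B A a) (formGramSchmidt B A b) = 0 := by
        rw [formResidual, map_sub, sub_apply, map_sum, sum_apply, Finset.sum_eq_single b]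
        · simp [hdiag]
        · intro c hc hcb
          rw [map_smul, smul_apply]
          rcases lt_or_gt_of_ne hcb with h | h
          · rw [hs (formGramSchmidt B A c) (formGramSchmidt B A b), ih b hb c h, smul_zero]
          · rw [ih c (Finset.mem_Iio.1 hc) b h, smul_zero]
        · intro h
          exact absurd (Finset.mem_Iio.2 hb) h
      rw [h, mul_zero]
  intro a b
  split_ifs with h
  · rw [h, hdiag]
  · rcases lt_or_gt_of_ne h with h | h
    · rw [hs, hlt b a h]
    · exact hlt a b h

theorem contDiffAt_formGramSchmidt {G : Type*} [NormedAddCommGroup G] [NormedSpace ℝ G]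
    {B : G → E →L[ℝ] E →L[ℝ] ℝ} {A : G → Fin n → E} {z : G} (hB : ContDiffAt ℝ ∞ B z)
    (hA : ContDiffAt ℝ ∞ A z) (hp : ∀ v, v ≠ 0 → 0 < B z v v)
    (hi : LinearIndependent ℝ (A z)) :
    ContDiffAt ℝ ∞ (fun y => formGramSchmidt (B y) (A y)) z := by
  refine contDiffAt_pi.2 fun a => ?_
  induction a using WellFoundedLT.induction with
  | ind a ih =>
    have hAa : ∀ b, ContDiffAt ℝ ∞ (fun y => A y b) z := contDiffAt_pi.1 hA
    have hr : ContDiffAt ℝ ∞ (fun y => formResidual (B y) (A y) a) z := by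
      refine (hAa a).sub (ContDiffAt.sum fun b hb => ?_)
      have hb' := ih b (Finset.mem_Iio.1 hb)
      exact ((hB.clm_apply (hAa a)).clm_apply hb').smul hb'
    have hpos := hp _ (formResidual_ne_zero (B z) hi a)
    simp only [formGramSchmidt_eq, formNormalize]
    refine ContDiffAt.smul (ContDiffAt.inv (ContDiffAt.sqrt ?_ hpos.ne') ?_) hr
    · exact (hB.clm_apply hr).clm_apply hr
    · exact (Real.sqrt_pos.2 hpos).ne'

theorem FormOrthonormal.apply_sum {B : E →L[ℝ] E →L[ℝ] ℝ} {e : Fin n → E}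
    (he : FormOrthonormal B e) (c : Fin n → ℝ) (a : Fin n) : B (∑ b, c b • e b) (e a) = c a := by
  rw [map_sum, sum_apply, Finset.sum_eq_single a]
  · simp [he a a]
  · intro b _ hb
    simp [he b a, hb]
  · simp

theorem FormOrthonormal.linearIndependent {B : E →L[ℝ] E →L[ℝ] ℝ} {e : Fin n → E}
    (he : FormOrthonormal B e) : LinearIndependent ℝ e := by
  rw [Fintype.linearIndependent_iff]
  intro c hc a
  rw [← he.apply_sum c a, hc]
  simp

/-- Every vector has the expansion `∑ B(v, e_a) e_a` in an orthonormal frame. -/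
theorem FormOrthonormal.sum_eq {B : E →L[ℝ] E →L[ℝ] ℝ} {e : Fin n → E}
    [FiniteDimensional ℝ E] (he : FormOrthonormal B e) (hn : Module.finrank ℝ E = n) (v : E) :
    ∑ a, B v (e a) • e a = v := by
  have hspan := he.linearIndependent.span_eq_top_of_card_eq_finrank' (by simp [hn])
  obtain ⟨c, rfl⟩ := (Submodule.mem_span_range_iff_exists_fun ℝ).1
    (hspan ▸ Submodule.mem_top : v ∈ Submodule.span ℝ (Set.range e))
  simp only [he.apply_sum]

end GramSchmidt

/-! ### Changes of charts and rigidity -/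

/-- A map of finite order whose derivative at a fixed point is the identity is the identity near
this point. -/
theorem eventually_apply_eq_self_of_iterate_eq_id {E : Type*} [NormedAddCommGroup E]
    [NormedSpace ℝ E] [CompleteSpace E] {f : E → E} {x : E} {N : ℕ} (hN : N ≠ 0)
    (hf : f^[N] = id) (hx : f x = x) (h : HasStrictFDerivAt f (ContinuousLinearMap.id ℝ E) x) :
    ∀ᶠ y in 𝓝 x, f y = y := by
  -- The mean `F` of the iterates of `f` is invariant under `f` and has derivative `id` at `x`.
  set F : E → E := fun y => (N : ℝ)⁻¹ • ∑ k ∈ Finset.range N, f^[k] y with hF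
  have hinv : ∀ y, F (f y) = F y := fun y => by
    have h1 := Finset.sum_range_succ (fun k => f^[k] y) N
    rw [Finset.sum_range_succ', hf] at h1
    simp only [id_eq, Function.iterate_zero] at h1
    simp only [hF, ← Function.iterate_succ_apply, add_right_cancel h1]
  have hd : HasStrictFDerivAt F ((ContinuousLinearEquiv.refl ℝ E : E ≃L[ℝ] E) : E →L[ℝ] E) x := by
    have h1 : HasStrictFDerivAt F ((N : ℝ)⁻¹ • ∑ k ∈ Finset.range N, ContinuousLinearMap.id ℝ E)
        x := by
      refine HasStrictFDerivAt.const_smul (HasStrictFDerivAt.fun_sum fun k _ => ?_) _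
      have h2 := h.iterate hx k
      rwa [← ContinuousLinearMap.one_def, one_pow] at h2
    convert h1 using 1
    ext v
    have : (N : ℝ) ≠ 0 := Nat.cast_ne_zero.2 hN
    simp [← Nat.cast_smul_eq_nsmul ℝ, smul_smul, this]
  have hs := hd.toOpenPartialHomeomorph F |>.open_source.mem_nhds
    hd.mem_toOpenPartialHomeomorph_source
  have hs' : ∀ᶠ y in 𝓝 x, f y ∈ (hd.toOpenPartialHomeomorph F).source :=
    h.continuousAt.eventually_mem (by rwa [hx])
  filter_upwards [hs, hs'] with y hy hy'
  exact (hd.toOpenPartialHomeomorph F).injOn hy' hy (hinv y)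

/-- The model space of the charts. -/
abbrev Euc (n : ℕ) : Type := EuclideanSpace ℝ (Fin n)

/-- The space of pairs `(x, (A_1, …, A_n))` of a point and `n` vectors; the frame bundles of the
charts are submanifolds of it. -/
abbrev FrameSpace (n : ℕ) : Type := Euc n × (Fin n → Euc n)

namespace RiemannianOrbifold

variable {n : ℕ} {V : Type*} [TopologicalSpace V] (O : RiemannianOrbifold n V)

/-- Changes of charts from `U i` to `U j`. -/
abbrev Change (i j : O.ι) (φ : Euc n → Euc n) (W W' : Set (Euc n)) : Prop :=
  IsChartChange (O.U i) (O.U j) (O.g i) (O.g j) (O.q i) (O.q j) φ W W'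

variable {O} {i j k : O.ι}

theorem contDiffAt_g {x : Euc n} (hx : x ∈ O.U i) : ContDiffAt ℝ ∞ (O.g i) x :=
  (O.contDiffOn_g i).contDiffAt ((O.isOpen_U i).mem_nhds hx)

theorem contDiffAt_fun (f : O.Fun) {x : Euc n} (hx : x ∈ O.U i) :
    ContDiffAt ℝ ∞ (fun y => f (O.q i y)) x :=
  (f.2.contDiffOn i).contDiffAt ((O.isOpen_U i).mem_nhds hx)

theorem differentiableAt_fun (f : O.Fun) {x : Euc n} (hx : x ∈ O.U i) :
    DifferentiableAt ℝ (fun y => f (O.q i y)) x :=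
  (contDiffAt_fun f hx).differentiableAt (by simp)

theorem Γ_mapsTo {γ : Equiv.Perm (Euc n)} (hγ : γ ∈ O.Γ i) {x : Euc n} (hx : x ∈ O.U i) :
    γ x ∈ O.U i :=
  (O.Γ_isometry i γ hγ).bijOn.mapsTo hx

theorem q_Γ {γ : Equiv.Perm (Euc n)} (hγ : γ ∈ O.Γ i) {x : Euc n} (hx : x ∈ O.U i) :
    O.q i (γ x) = O.q i x :=
  ((O.q_eq_iff i x hx _ (Γ_mapsTo hγ hx)).2 ⟨γ, hγ, rfl⟩).symm

theorem Γ_change {γ : Equiv.Perm (Euc n)} (hγ : γ ∈ O.Γ i) : O.Change i i γ (O.U i) (O.U i) :=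
  ⟨subset_rfl, subset_rfl, O.isOpen_U i, O.isOpen_U i, O.isConnected_U i, O.isConnected_U i,
    O.Γ_isometry i γ hγ, fun _ hx => q_Γ hγ hx⟩

namespace Change

variable {φ ψ : Euc n → Euc n} {W W' Y Y' : Set (Euc n)} (h : O.Change i j φ W W')
include h

theorem contDiffAt {x : Euc n} (hx : x ∈ W) : ContDiffAt ℝ ∞ φ x :=
  h.isometry.contDiffOn.contDiffAt (h.isOpen.mem_nhds hx)

theorem differentiableAt {x : Euc n} (hx : x ∈ W) : DifferentiableAt ℝ φ x :=
  (h.contDiffAt hx).differentiableAt (by simp)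

theorem apply_mem {x : Euc n} (hx : x ∈ W) : φ x ∈ O.U j :=
  h.subset' (h.isometry.bijOn.mapsTo hx)

theorem fderiv_injective {x : Euc n} (hx : x ∈ W) : Function.Injective (fderiv ℝ φ x) := by
  rw [injective_iff_map_eq_zero]
  intro v hv
  by_contra hne
  have h1 := O.g_pos i x (h.subset hx) v hne
  rw [← h.isometry.metric x hx, hv] at h1
  simp at h1

theorem fderiv_surjective {x : Euc n} (hx : x ∈ W) : Function.Surjective (fderiv ℝ φ x) :=
  LinearMap.injective_iff_surjective.1 (h.fderiv_injective hx)

theorem map_nhds {x : Euc n} (hx : x ∈ W) : map φ (𝓝 x) = 𝓝 (φ x) :=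
  ((h.contDiffAt hx).hasStrictFDerivAt (by simp)).map_nhds_eq_of_surj
    (LinearMap.range_eq_top.2 (h.fderiv_surjective hx))

theorem mono {Z : Set (Euc n)} (hZ : Z ⊆ W) (ho : IsOpen Z) (hc : IsConnected Z) :
    O.Change i j φ Z (φ '' Z) where
  subset := hZ.trans h.subset
  subset' := (image_mono hZ).trans (h.isometry.bijOn.image_eq.subset.trans h.subset')
  isOpen := ho
  isOpen' := by
    rw [isOpen_iff_mem_nhds]
    rintro _ ⟨x, hx, rfl⟩
    rw [← h.map_nhds (hZ hx)]
    exact image_mem_map (ho.mem_nhds hx)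
  isConnected := hc
  isConnected' := hc.image _ (h.isometry.contDiffOn.continuousOn.mono hZ)
  isometry := ⟨h.isometry.contDiffOn.mono hZ, (h.isometry.bijOn.injOn.mono hZ).bijOn_image,
    fun x hx => h.isometry.metric x (hZ hx)⟩
  comp_eq x hx := h.comp_eq x (hZ hx)

/-- Changes of charts can be composed after restriction to a small ball. -/
theorem comp (h' : O.Change j k ψ Y Y') {x : Euc n} (hx : x ∈ W) (hy : φ x ∈ Y) :
    ∃ Z ⊆ W, x ∈ Z ∧ φ '' Z ⊆ Y ∧ ∃ Z', O.Change i k (ψ ∘ φ) Z Z' := by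
  have hn : W ∩ φ ⁻¹' Y ∈ 𝓝 x := inter_mem (h.isOpen.mem_nhds hx)
    ((h.contDiffAt hx).continuousAt.preimage_mem_nhds (h'.isOpen.mem_nhds hy))
  obtain ⟨r, hr, hsub⟩ := Metric.mem_nhds_iff.1 hn
  have hZ : IsConnected (Metric.ball x r) :=
    ⟨⟨x, Metric.mem_ball_self hr⟩, (convex_ball x r).isPreconnected⟩
  have h1 := h.mono (hsub.trans inter_subset_left) Metric.isOpen_ball hZ
  have hYs : φ '' Metric.ball x r ⊆ Y := by
    rintro _ ⟨y, hy, rfl⟩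
    exact (hsub hy).2
  have h2 := h'.mono hYs h1.isOpen' h1.isConnected'
  refine ⟨_, hsub.trans inter_subset_left, Metric.mem_ball_self hr, hYs,
    ψ '' (φ '' Metric.ball x r), h1.subset, h2.subset', h1.isOpen, h2.isOpen', h1.isConnected,
    h2.isConnected', ⟨h2.isometry.contDiffOn.comp h1.isometry.contDiffOn
      h1.isometry.bijOn.mapsTo, h2.isometry.bijOn.comp h1.isometry.bijOn, fun y hy v w => ?_⟩,
    fun y hy => ?_⟩
  · have hy' : φ y ∈ φ '' Metric.ball x r := mem_image_of_mem _ hy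
    rw [fderiv_comp y (h2.differentiableAt hy') (h1.differentiableAt hy)]
    simp only [Function.comp_apply, ContinuousLinearMap.comp_apply]
    rw [h2.isometry.metric _ hy', h1.isometry.metric _ hy]
  · rw [Function.comp_apply, h2.comp_eq _ (mem_image_of_mem _ hy), h1.comp_eq _ hy]

end Change

theorem Γ_contDiffAt {γ : Equiv.Perm (Euc n)} (hγ : γ ∈ O.Γ i) {x : Euc n} (hx : x ∈ O.U i) :
    ContDiffAt ℝ ∞ γ x := (Γ_change hγ).contDiffAt hx

theorem Γ_differentiableAt {γ : Equiv.Perm (Euc n)} (hγ : γ ∈ O.Γ i) {x : Euc n}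
    (hx : x ∈ O.U i) : DifferentiableAt ℝ γ x := (Γ_change hγ).differentiableAt hx

/-- An element of `Γ i` with a fixed point at which its derivative is the identity is trivial. -/
theorem Γ_eq_one_of_fderiv_eq_id {γ : Equiv.Perm (Euc n)} (hγ : γ ∈ O.Γ i) {x : Euc n}
    (hx : x ∈ O.U i) (hfix : γ x = x) (hd : fderiv ℝ γ x = ContinuousLinearMap.id ℝ (Euc n)) :
    γ = 1 := by
  have := O.finite_Γ i
  obtain ⟨N, hN, hpow⟩ : ∃ N : ℕ, N ≠ 0 ∧ (γ : Euc n → Euc n)^[N] = id := by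
    refine ⟨orderOf (⟨γ, hγ⟩ : O.Γ i), (orderOf_pos _).ne', ?_⟩
    have h := pow_orderOf_eq_one (⟨γ, hγ⟩ : O.Γ i)
    have h2 : γ ^ orderOf (⟨γ, hγ⟩ : O.Γ i) = 1 := congrArg Subtype.val h
    rw [Equiv.Perm.iterate_eq_pow, h2]
    rfl
  -- The points with this property form an open and closed subset of `U i`.
  set S : Set (Euc n) := {y | γ y = y ∧ fderiv ℝ γ y = ContinuousLinearMap.id ℝ (Euc n)} with hS
  have hopen : ∀ y ∈ O.U i, y ∈ S → ∀ᶠ z in 𝓝 y, z ∈ S := by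
    intro y hy hyS
    have h1 := (Γ_contDiffAt hγ hy).hasStrictFDerivAt (by simp)
    rw [hyS.2] at h1
    have h2 := eventually_apply_eq_self_of_iterate_eq_id hN hpow hyS.1 h1
    filter_upwards [h2, h2.eventually_nhds] with z hz hz'
    refine ⟨hz, ?_⟩
    have : (γ : Euc n → Euc n) =ᶠ[𝓝 z] id := hz'
    rw [this.fderiv_eq, fderiv_id]
  have hclosed : ∀ y ∈ O.U i, y ∉ S → ∀ᶠ z in 𝓝 y, z ∉ S := by
    intro y hy hyS
    have hc := (Γ_contDiffAt hγ hy)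
    rw [hS, mem_ofPred_eq, not_and_or] at hyS
    rcases hyS with h | h
    · filter_upwards [(hc.continuousAt.prodMk continuousAt_id).eventually_mem
        (isOpen_ne_fun continuous_fst continuous_snd |>.mem_nhds h)] with z hz hzS
      exact hz hzS.1
    · have hc' : ContinuousAt (fderiv ℝ γ) y :=
        (hc.fderiv_right (m := ∞) (by simp)).continuousAt
      filter_upwards [hc'.eventually_ne h] with z hz hzS
      exact hz hzS.2
  have hall : O.U i ⊆ S := by
    by_contra hne
    obtain ⟨y, hy, hyS⟩ := not_subset.1 hne
    obtain ⟨z, hz, hz1, hz2⟩ := (O.isConnected_U i).isPreconnected (interior S) (interior Sᶜ)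
      isOpen_interior isOpen_interior (fun z hz => by
        by_cases h : z ∈ S
        · exact Or.inl (mem_interior_iff_mem_nhds.2 (hopen z hz h))
        · exact Or.inr (mem_interior_iff_mem_nhds.2 (hclosed z hz h)))
      ⟨x, hx, mem_interior_iff_mem_nhds.2 (hopen x hx ⟨hfix, hd⟩)⟩
      ⟨y, hy, mem_interior_iff_mem_nhds.2 (hclosed y hy hyS)⟩
    exact interior_subset hz2 (interior_subset hz1)
  ext1 y
  by_cases hy : y ∈ O.U i
  · exact (hall hy).1
  · exact O.Γ_eq_self i γ hγ y hy

theorem Γ_eq_of_fderiv_eq {γ δ : Equiv.Perm (Euc n)} (hγ : γ ∈ O.Γ i) (hδ : δ ∈ O.Γ i) {x : Euc n}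
    (hx : x ∈ O.U i) (h : γ x = δ x) (hd : fderiv ℝ γ x = fderiv ℝ δ x) : γ = δ := by
  have hinv := inv_mem hγ
  have key : ∀ ε ∈ O.Γ i, ε x = γ x → fderiv ℝ (γ⁻¹ * ε : Equiv.Perm (Euc n)) x =
      (fderiv ℝ (γ⁻¹ : Equiv.Perm (Euc n)) (γ x)).comp (fderiv ℝ ε x) := by
    intro ε hε he
    rw [Equiv.Perm.coe_mul,
      fderiv_comp x (by rw [he]; exact Γ_differentiableAt hinv (Γ_mapsTo hγ hx))
      (Γ_differentiableAt hε hx), he]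
  have h1 : γ⁻¹ * δ = 1 := by
    refine Γ_eq_one_of_fderiv_eq_id (mul_mem hinv hδ) hx (by simp [← h]) ?_
    rw [key δ hδ h.symm, ← hd, ← key γ hγ rfl, inv_mul_cancel]
    exact fderiv_id
  exact inv_mul_eq_one.1 h1

/-- An element of `Γ i` that is the identity near some point is trivial. -/
theorem Γ_eq_one_of_eventually {γ : Equiv.Perm (Euc n)} (hγ : γ ∈ O.Γ i) {x : Euc n}
    (hx : x ∈ O.U i) (h : ∀ᶠ y in 𝓝 x, γ y = y) : γ = 1 := by
  refine Γ_eq_one_of_fderiv_eq_id hγ hx h.self_of_nhds ?_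
  have : (γ : Euc n → Euc n) =ᶠ[𝓝 x] id := h
  rw [this.fderiv_eq, fderiv_id]

/-! ### Regular points -/

variable (O) in
/-- Points of a chart with trivial isotropy. -/
def IsRegular (i : O.ι) (x : Euc n) : Prop := ∀ γ ∈ O.Γ i, γ x = x → γ = 1

/-- A point of a chart is a limit of regular points. -/
theorem frequently_isRegular {x : Euc n} (hx : x ∈ O.U i) : ∃ᶠ y in 𝓝 x, O.IsRegular i y := by
  have := O.finite_Γ i
  have : LocallyCompactSpace (O.U i) := (O.isOpen_U i).locallyCompactSpace
  have hc : ∀ γ : O.Γ i, Continuous fun y : O.U i => γ.1 y := fun γ =>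
    continuousOn_iff_continuous_domRestrict.1 (O.Γ_isometry i γ γ.2).contDiffOn.continuousOn
  set D : {γ : O.Γ i // γ ≠ 1} → Set (O.U i) := fun γ => {y | γ.1.1 y ≠ y} with hD
  have hd : Dense (⋂ γ, D γ) := by
    refine dense_iInter_of_isOpen (fun γ => isOpen_ne_fun (hc γ.1) continuous_subtype_val)
      fun γ => ?_
    rw [← compl_compl (D γ), ← interior_eq_empty_iff_dense_compl, eq_empty_iff_forall_notMem]
    intro y hy
    refine γ.2 (Subtype.ext (Γ_eq_one_of_eventually γ.1.2 y.2 ?_))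
    have h1 : ∀ᶠ z : O.U i in 𝓝 y, γ.1.1 z = z := by
      filter_upwards [mem_interior_iff_mem_nhds.1 hy] with z hz
      simpa [hD] using hz
    rw [← (O.isOpen_U i).isOpenEmbedding_subtypeVal.map_nhds_eq y]
    exact h1
  have hreg : ∀ y ∈ ⋂ γ, D γ, O.IsRegular i y := fun y hy γ hγ hfix => by
    by_contra hne
    exact mem_iInter.1 hy ⟨⟨γ, hγ⟩, fun h => hne (congrArg Subtype.val h)⟩ hfix
  have h2 : ∃ᶠ y : O.U i in 𝓝 ⟨x, hx⟩, O.IsRegular i y :=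
    ((mem_closure_iff_frequently.1 (hd ⟨x, hx⟩))).mono hreg
  rw [← (O.isOpen_U i).isOpenEmbedding_subtypeVal.map_nhds_eq ⟨x, hx⟩]
  exact frequently_map.2 h2

/-- A change of charts from `U i` to itself is given by an element of `Γ i`. -/
theorem Change.exists_eqOn_Γ {φ : Euc n → Euc n} {W W' : Set (Euc n)} (h : O.Change i i φ W W') :
    ∃ γ ∈ O.Γ i, ∀ x ∈ W, φ x = γ x := by
  have := O.finite_Γ i
  have : LocallyCompactSpace W := h.isOpen.locallyCompactSpace
  have hcd : ∀ γ : O.Γ i, ContDiffOn ℝ ∞ γ.1 W := fun γ =>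
    (O.Γ_isometry i γ γ.2).contDiffOn.mono h.subset
  have hcont : ∀ {F : Type} [TopologicalSpace F] {f : Euc n → F}, ContinuousOn f W →
      Continuous fun x : W => f x := fun hf => continuousOn_iff_continuous_domRestrict.1 hf
  have hfd : ∀ {f : Euc n → Euc n}, ContDiffOn ℝ ∞ f W → ContinuousOn (fderiv ℝ f) W :=
    fun hf => (hf.fderiv_of_isOpen (m := ∞) h.isOpen (by simp)).continuousOn
  -- The sets where `φ` agrees with `γ` to first order are closed, disjoint and cover `W`.
  set A : O.Γ i → Set W := fun γ => {x | φ x = γ.1 x ∧ fderiv ℝ φ x = fderiv ℝ γ.1 x} with hA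
  set B : O.Γ i → Set W := fun γ => {x | φ x = γ.1 x} with hB
  have hAc : ∀ γ, IsClosed (A γ) := fun γ =>
    (isClosed_eq (hcont h.isometry.contDiffOn.continuousOn) (hcont (hcd γ).continuousOn)).inter
      (isClosed_eq (hcont (hfd h.isometry.contDiffOn)) (hcont (hfd (hcd γ))))
  have hBc : ∀ γ, IsClosed (B γ) := fun γ =>
    isClosed_eq (hcont h.isometry.contDiffOn.continuousOn) (hcont (hcd γ).continuousOn)
  have hBu : ⋃ γ, B γ = univ := eq_univ_of_forall fun x => by
    obtain ⟨γ, hγ, he⟩ := (O.q_eq_iff i x (h.subset x.2) _ (h.apply_mem x.2)).1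
      (h.comp_eq x x.2).symm
    exact mem_iUnion.2 ⟨⟨γ, hγ⟩, he.symm⟩
  have hBA : ∀ γ, interior (B γ) ⊆ A γ := fun γ x hx => by
    have hxB : x ∈ B γ := interior_subset hx
    refine ⟨hxB, ?_⟩
    have h1 : ∀ᶠ z : W in 𝓝 x, φ z = γ.1 z := mem_interior_iff_mem_nhds.1 hx
    have h2 : φ =ᶠ[𝓝 x.1] γ.1 := by
      rw [EventuallyEq, ← h.isOpen.isOpenEmbedding_subtypeVal.map_nhds_eq x]
      exact h1
    exact h2.fderiv_eq
  have hAu : ⋃ γ, A γ = univ := by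
    rw [← (isClosed_iUnion_of_finite hAc).closure_eq]
    exact ((dense_iUnion_interior_of_closed hBc hBu).mono (iUnion_mono hBA)).closure_eq
  have hAd : ∀ γ δ x, x ∈ A γ → x ∈ A δ → γ = δ := fun γ δ x h1 h2 => Subtype.ext
    (Γ_eq_of_fderiv_eq γ.2 δ.2 (h.subset x.2) (h1.1.symm.trans h2.1) (h1.2.symm.trans h2.2))
  choose c hc using fun x => mem_iUnion.1 (hAu ▸ mem_univ x : x ∈ ⋃ γ, A γ)
  have hlc : IsLocallyConstant c := fun s => by
    rw [← isClosed_compl_iff]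
    have : (c ⁻¹' s)ᶜ = ⋃ γ : (sᶜ : Set (O.Γ i)), A γ := by
      ext x
      simp only [mem_compl_iff, mem_preimage, mem_iUnion]
      refine ⟨fun hx => ⟨⟨c x, hx⟩, hc x⟩, ?_⟩
      rintro ⟨γ, hγ⟩ hx
      exact γ.2 (hAd _ _ _ hγ (hc x) ▸ hx)
    rw [this]
    exact isClosed_iUnion_of_finite fun γ => hAc γ
  have : PreconnectedSpace W := isPreconnected_iff_preconnectedSpace.1 h.isConnected.isPreconnected
  obtain ⟨x₀, hx₀⟩ := h.isConnected.nonempty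
  refine ⟨c ⟨x₀, hx₀⟩, (c ⟨x₀, hx₀⟩).2, fun x hx => ?_⟩
  rw [hlc.apply_eq_of_preconnectedSpace ⟨x₀, hx₀⟩ ⟨x, hx⟩]
  exact (hc ⟨x, hx⟩).1

end RiemannianOrbifold

/-! ### The action of changes of charts on frames -/

/-- The lift of a map to frames, `(x, A) ↦ (φ(x), dφ_x A)`. -/
def frameLift {n : ℕ} (φ : Euc n → Euc n) (z : FrameSpace n) : FrameSpace n :=
  (φ z.1, fun a => fderiv ℝ φ z.1 (z.2 a))

theorem frameLift_comp {n : ℕ} {φ ψ : Euc n → Euc n} {z : FrameSpace n}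
    (hψ : DifferentiableAt ℝ ψ (φ z.1)) (hφ : DifferentiableAt ℝ φ z.1) :
    frameLift (ψ ∘ φ) z = frameLift ψ (frameLift φ z) := by
  simp only [frameLift, fderiv_comp _ hψ hφ]
  rfl

theorem frameLift_congr {n : ℕ} {φ ψ : Euc n → Euc n} {z : FrameSpace n} (h : φ =ᶠ[𝓝 z.1] ψ) :
    frameLift φ z = frameLift ψ z := by
  simp only [frameLift, h.fderiv_eq, h.self_of_nhds]

theorem frameLift_id {n : ℕ} (z : FrameSpace n) : frameLift id z = z := by
  simp [frameLift]

theorem contDiffAt_frameLift {n : ℕ} {φ : Euc n → Euc n} {z : FrameSpace n}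
    (h : ContDiffAt ℝ ∞ φ z.1) : ContDiffAt ℝ ∞ (frameLift φ) z := by
  refine (h.comp z contDiffAt_fst).prodMk (contDiffAt_pi.2 fun a => ?_)
  exact ((h.fderiv_right (m := ∞) (by simp)).comp z contDiffAt_fst).clm_apply
    ((contDiff_apply ℝ (Euc n) a).comp contDiff_snd).contDiffAt

namespace RiemannianOrbifold

variable {n : ℕ} {V : Type*} [TopologicalSpace V] {O : RiemannianOrbifold n V} {i j k : O.ι}
  {φ : Euc n → Euc n} {W W' : Set (Euc n)} {z w : FrameSpace n}

theorem Change.frameLift_mem (h : O.Change i j φ W W') (hz : z ∈ O.frames i) (hW : z.1 ∈ W) :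
    frameLift φ z ∈ O.frames j :=
  ⟨h.apply_mem hW, fun a b => by
    rw [← hz.2 a b, ← h.isometry.metric _ hW]
    rfl⟩

theorem formOrthonormal_of_mem_frames (hz : z ∈ O.frames i) : FormOrthonormal (O.g i z.1) z.2 :=
  hz.2

/-- The point of the resolution represented by a frame of the chart `U i`. -/
abbrev framePt (i : O.ι) (z : FrameSpace n) (hz : z ∈ O.frames i) : O.Res := Quot.mk _ ⟨i, z, hz⟩

variable (O) in
/-- The relation `FrameRel` between frames, in terms of the lifts of changes of charts. -/
def LiftRel (i j : O.ι) (z w : FrameSpace n) : Prop :=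
  ∃ φ W W', O.Change i j φ W W' ∧ z.1 ∈ W ∧ frameLift φ z = w

theorem liftRel_refl (hz : z.1 ∈ O.U i) : O.LiftRel i i z z :=
  ⟨_, _, _, Γ_change (one_mem _), hz, frameLift_id z⟩

theorem LiftRel.trans {u : FrameSpace n} (h : O.LiftRel i j z w) (h' : O.LiftRel j k w u) :
    O.LiftRel i k z u := by
  obtain ⟨φ, W, W', hφ, hz, rfl⟩ := h
  obtain ⟨ψ, Y, Y', hψ, hw, rfl⟩ := h'
  obtain ⟨Z, -, hzZ, -, Z', hc⟩ := hφ.comp hψ hz hw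
  exact ⟨_, Z, Z', hc, hzZ, frameLift_comp (Change.differentiableAt hψ hw) (hφ.differentiableAt hz)⟩

theorem LiftRel.symm (h : O.LiftRel i j z w) : O.LiftRel j i w z := by
  obtain ⟨φ, W, W', hφ, hz, rfl⟩ := h
  -- Some change of charts `ψ` leads back; `ψ ∘ φ` is an element of `Γ i`, which is removed.
  obtain ⟨ψ, Y, Y', hψ, hw, -⟩ := O.exists_change j i (φ z.1) (hφ.apply_mem hz) z.1 (hφ.subset hz)
    (hφ.comp_eq _ hz)
  obtain ⟨Z, hZW, hzZ, hZY, Z', hc⟩ := hφ.comp hψ hz hw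
  obtain ⟨γ, hγ, he⟩ := hc.exists_eqOn_Γ
  have hγ' := inv_mem hγ
  obtain ⟨X, hXY, hwX, -, X', hc'⟩ := Change.comp hψ (Γ_change hγ') hw (Change.apply_mem hψ hw)
  refine ⟨_, X, X', hc', hwX, ?_⟩
  rw [← frameLift_comp (hc'.differentiableAt hwX) (hφ.differentiableAt hz)]
  refine (frameLift_congr (ψ := id) ?_).trans (frameLift_id z)
  filter_upwards [hc.isOpen.mem_nhds hzZ] with y hy
  change γ⁻¹ ((ψ ∘ φ) y) = y
  rw [he y hy]
  exact γ.symm_apply_apply y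

theorem framePt_eq_framePt_iff {hz : z ∈ O.frames i} {hw : w ∈ O.frames j} :
    framePt i z hz = framePt j w hw ↔ O.LiftRel i j z w := by
  have hrel : ∀ a b : Σ i, O.frames i, O.FrameRel a b ↔ O.LiftRel a.1 b.1 a.2 b.2 := fun a b => by
    refine ⟨fun ⟨φ, W, W', h, h1, h2, h3⟩ => ⟨φ, W, W', h, h1, Prod.ext h2 (funext h3)⟩,
      fun ⟨φ, W, W', h, h1, h2⟩ => ⟨φ, W, W', h, h1, congrArg Prod.fst h2, fun a => ?_⟩⟩
    exact congrFun (congrArg Prod.snd h2) a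
  have heq : Equivalence O.FrameRel :=
    ⟨fun a => (hrel a a).2 (liftRel_refl a.2.2.1), fun h => (hrel _ _).2 ((hrel _ _).1 h).symm,
      fun h h' => (hrel _ _).2 (((hrel _ _).1 h).trans ((hrel _ _).1 h'))⟩
  exact (Quot.eq.trans heq.eqvGen_iff).trans (hrel _ _)

theorem Change.framePt_frameLift (h : O.Change i j φ W W') (hz : z ∈ O.frames i) (hW : z.1 ∈ W) :
    framePt j (frameLift φ z) (h.frameLift_mem hz hW) = framePt i z hz :=
  (framePt_eq_framePt_iff.2 ⟨φ, W, W', h, hW, rfl⟩).symm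

theorem exists_Γ_of_framePt_eq_framePt {hz : z ∈ O.frames i} {hw : w ∈ O.frames i}
    (h : framePt i z hz = framePt i w hw) : ∃ γ ∈ O.Γ i, frameLift γ z = w := by
  obtain ⟨φ, W, W', hφ, hzW, rfl⟩ := framePt_eq_framePt_iff.1 h
  obtain ⟨γ, hγ, he⟩ := hφ.exists_eqOn_Γ
  refine ⟨γ, hγ, frameLift_congr ?_⟩
  filter_upwards [hφ.isOpen.mem_nhds hzW] with y hy using (he y hy).symm

theorem exists_framePt_eq (ρ : O.Res) : ∃ i z, ∃ hz : z ∈ O.frames i, framePt i z hz = ρ := by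
  induction ρ using Quot.ind with
  | mk a => exact ⟨a.1, a.2.1, a.2.2, rfl⟩

end RiemannianOrbifold

/-! ### Bump functions and free neighbourhoods -/

theorem exists_bump {E : Type*} [NormedAddCommGroup E] [NormedSpace ℝ E] [FiniteDimensional ℝ E]
    {x : E} {N : Set E} (hN : N ∈ 𝓝 x) : ∃ χ : E → ℝ, ContDiff ℝ ∞ χ ∧ HasCompactSupport χ ∧
      tsupport χ ⊆ N ∧ ∀ᶠ y in 𝓝 x, χ y = 1 := by
  obtain ⟨r, hr, hsub⟩ := Metric.nhds_basis_closedBall.mem_iff.1 hN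
  let c : ContDiffBump x := ⟨r / 2, r, by positivity, by linarith⟩
  exact ⟨c, c.contDiff, c.hasCompactSupport, by rw [c.tsupport_eq]; exact hsub, c.eventuallyEq_one⟩

theorem exists_contDiff_eventuallyEq {E : Type*} [NormedAddCommGroup E] [NormedSpace ℝ E]
    [FiniteDimensional ℝ E] {x : E} {N : Set E} (hN : IsOpen N) (hx : x ∈ N) {h : E → ℝ}
    (hh : ContDiffOn ℝ ∞ h N) : ∃ h' : E → ℝ, ContDiff ℝ ∞ h' ∧ h' =ᶠ[𝓝 x] h := by
  obtain ⟨χ, hχ, -, hs, h1⟩ := exists_bump (hN.mem_nhds hx)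
  refine ⟨fun y => χ y * h y, contDiff_iff_contDiffAt.2 fun y => ?_, ?_⟩
  · by_cases hy : y ∈ tsupport χ
    · exact hχ.contDiffAt.mul (hh.contDiffAt (hN.mem_nhds (hs hy)))
    · refine contDiffAt_const (c := (0 : ℝ)) |>.congr_of_eventuallyEq ?_
      filter_upwards [(isClosed_tsupport χ).isOpen_compl.mem_nhds hy] with w hw
      rw [image_eq_zero_of_notMem_tsupport hw, zero_mul]
  · filter_upwards [h1] with y hy
    rw [hy, one_mul]

/-- Finitely many maps that move the point `x` move it out of some neighbourhood. -/
theorem exists_isOpen_forall_notMem {κ X : Type*} [Finite κ] [TopologicalSpace X] [T2Space X]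
    {f : κ → X → X} {x : X} {s : Set X} (hs : s ∈ 𝓝 x) (hc : ∀ a, ContinuousAt (f a) x)
    (hne : ∀ a, f a x ≠ x) :
    ∃ N ⊆ s, IsOpen N ∧ x ∈ N ∧ ∀ a, ∀ y ∈ N, f a y ∉ N := by
  have h : ∀ a, ∃ M ∈ 𝓝 x, ∀ y ∈ M, f a y ∉ M := fun a => by
    obtain ⟨A, B, hA, hB, hxA, hxB, hd⟩ := t2_separation (hne a)
    refine ⟨B ∩ f a ⁻¹' A, inter_mem (hB.mem_nhds hxB)
      ((hc a).preimage_mem_nhds (hA.mem_nhds hxA)), fun y hy hy' => ?_⟩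
    exact hd.notMem_of_mem_left hy.2 hy'.1
  choose M hM hfM using h
  have hmem : s ∩ ⋂ a, M a ∈ 𝓝 x := inter_mem hs (iInter_mem.2 hM)
  refine ⟨interior (s ∩ ⋂ a, M a), interior_subset.trans inter_subset_left, isOpen_interior,
    mem_interior_iff_mem_nhds.2 hmem, fun a y hy hy' => ?_⟩
  exact hfM a y (mem_iInter.1 (interior_subset hy).2 a) (mem_iInter.1 (interior_subset hy').2 a)

namespace RiemannianOrbifold

variable {n : ℕ} {V : Type*} [TopologicalSpace V] {O : RiemannianOrbifold n V} {i j k : O.ι}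
  {φ : Euc n → Euc n} {W W' : Set (Euc n)} {z w : FrameSpace n}

/-- The change of charts between two points over the same point of the orbifold can be chosen to map
one of them to the other. -/
theorem exists_change_apply_eq {x y : Euc n} (hx : x ∈ O.U i) (hy : y ∈ O.U j)
    (h : O.q i x = O.q j y) : ∃ φ W W', O.Change i j φ W W' ∧ x ∈ W ∧ φ x = y := by
  obtain ⟨φ, W, W', hφ, hxW, -⟩ := O.exists_change i j x hx y hy h
  have hφx : φ x ∈ O.U j := Change.apply_mem hφ hxW
  obtain ⟨γ, hγ, he⟩ := (O.q_eq_iff j (φ x) hφx y hy).1 ((hφ.comp_eq x hxW).trans h)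
  obtain ⟨Z, -, hxZ, -, Z', hc⟩ := Change.comp hφ (Γ_change hγ) hxW hφx
  exact ⟨_, Z, Z', hc, hxZ, he⟩

/-! ### Frames and the Gram–Schmidt retraction -/

variable (O) in
/-- The pairs of a point of `U i` and a basis; an open neighbourhood of the frame bundle. -/
def frameDomain (i : O.ι) : Set (FrameSpace n) := {z | z.1 ∈ O.U i ∧ LinearIndependent ℝ z.2}

variable (O) in
/-- The Gram–Schmidt retraction of `frameDomain i` onto the frame bundle of `U i`. -/
def retract (i : O.ι) (z : FrameSpace n) : FrameSpace n :=
  (z.1, formGramSchmidt (O.g i z.1) z.2)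

variable (O) in
theorem isOpen_frameDomain (i : O.ι) : IsOpen (O.frameDomain i) :=
  ((O.isOpen_U i).preimage continuous_fst).inter
    (isOpen_setOfPred_linearIndependent.preimage continuous_snd)

theorem frames_subset_frameDomain : O.frames i ⊆ O.frameDomain i := fun _ hz =>
  ⟨hz.1, (formOrthonormal_of_mem_frames hz).linearIndependent⟩

theorem retract_mem_frames (hz : z ∈ O.frameDomain i) : O.retract i z ∈ O.frames i :=
  ⟨hz.1, formOrthonormal_formGramSchmidt (O.g_symm i _ hz.1) (O.g_pos i _ hz.1) hz.2⟩

theorem retract_eq_self (hz : z ∈ O.frames i) : O.retract i z = z :=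
  Prod.ext rfl (formOrthonormal_of_mem_frames hz).formGramSchmidt

theorem contDiffOn_retract : ContDiffOn ℝ ∞ (O.retract i) (O.frameDomain i) := fun z hz =>
  (contDiffAt_fst.prodMk (contDiffAt_formGramSchmidt (z := z)
    ((contDiffAt_g hz.1).comp z contDiffAt_fst) contDiffAt_snd (O.g_pos i _ hz.1)
    hz.2)).contDiffWithinAt

theorem Change.retract_frameLift (h : O.Change i j φ W W') (hz : z.1 ∈ W) :
    O.retract j (frameLift φ z) = frameLift φ (O.retract i z) :=
  Prod.ext rfl (funext fun a => formGramSchmidt_comp (h.isometry.metric _ hz) z.2 a)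

variable (O) in
/-- A smooth orthonormal frame on `U i`. -/
def frameSection (i : O.ι) (x : Euc n) : FrameSpace n :=
  O.retract i (x, fun a => EuclideanSpace.single a 1)

theorem mk_single_mem_frameDomain {x : Euc n} (hx : x ∈ O.U i) :
    ((x, fun a => EuclideanSpace.single a 1) : FrameSpace n) ∈ O.frameDomain i := by
  refine ⟨hx, ?_⟩
  have he : (fun a : Fin n => EuclideanSpace.single a (1 : ℝ)) =
      EuclideanSpace.basisFun (Fin n) ℝ := funext fun a => by simp
  have h := (EuclideanSpace.basisFun (Fin n) ℝ).toBasis.linearIndependent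
  rwa [OrthonormalBasis.coe_toBasis, ← he] at h

theorem frameSection_mem_frames {x : Euc n} (hx : x ∈ O.U i) : O.frameSection i x ∈ O.frames i :=
  retract_mem_frames (mk_single_mem_frameDomain hx)

theorem contDiffOn_frameSection : ContDiffOn ℝ ∞ (O.frameSection i) (O.U i) :=
  contDiffOn_retract.comp (contDiff_id.prodMk contDiff_const).contDiffOn
    fun _ hx => mk_single_mem_frameDomain hx

/-! ### Extension of functions from a chart to the orbifold -/

/-- Near a regular point of a chart, every smooth function comes from a smooth function of the
orbifold. -/
theorem IsRegular.exists_fun_eventuallyEq [T2Space V] {x : Euc n} (hreg : O.IsRegular i x)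
    (hx : x ∈ O.U i) {h : Euc n → ℝ} (hh : ContDiff ℝ ∞ h) :
    ∃ f : O.Fun, (fun y => f (O.q i y)) =ᶠ[𝓝 x] h := by
  classical
  have := O.finite_Γ i
  obtain ⟨N, hNU, hNo, hxN, hN⟩ := exists_isOpen_forall_notMem
    (κ := {γ : O.Γ i // γ ≠ 1}) (f := fun γ => γ.1.1) ((O.isOpen_U i).mem_nhds hx)
    (fun γ => (Γ_contDiffAt γ.1.2 hx).continuousAt)
    fun γ hγ => γ.2 (Subtype.ext (hreg _ γ.1.2 hγ))
  have hinj : InjOn (O.q i) N := fun y hy y' hy' he => by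
    obtain ⟨γ, hγ, rfl⟩ := (O.q_eq_iff i y (hNU hy) y' (hNU hy')).1 he
    by_contra hne
    refine hN ⟨⟨γ, hγ⟩, fun h1 => hne ?_⟩ y hy hy'
    rw [show γ = 1 from congrArg Subtype.val h1]
    rfl
  obtain ⟨χ, hχ, hcs, hsub, hone⟩ := exists_bump (hNo.mem_nhds hxN)
  -- The function `χ h`, transported to the image of `N` and extended by zero.
  set f : V → ℝ := fun v => if hv : v ∈ O.q i '' N then χ hv.choose * h hv.choose else 0 with hf
  have hfN : ∀ y ∈ N, f (O.q i y) = χ y * h y := fun y hy => by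
    have hv : O.q i y ∈ O.q i '' N := mem_image_of_mem _ hy
    rw [hf]
    simp only [dif_pos hv]
    rw [hinj hv.choose_spec.1 hy hv.choose_spec.2]
  have hK : IsClosed (O.q i '' tsupport χ) :=
    (hcs.image_of_continuousOn ((O.continuousOn_q i).mono (hsub.trans hNU))).isClosed
  have hf0 : ∀ v ∉ O.q i '' tsupport χ, f v = 0 := fun v hv => by
    by_cases hvN : v ∈ O.q i '' N
    · obtain ⟨y, hy, rfl⟩ := hvN
      rw [hfN y hy, image_eq_zero_of_notMem_tsupport fun hy' => hv (mem_image_of_mem _ hy'),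
        zero_mul]
    · rw [hf]
      simp only [dif_neg hvN]
  have hsm : O.IsSmooth f := O.isSmooth_of_forall fun j y hy => by
    refine ContDiffAt.contDiffWithinAt ?_
    by_cases hv : O.q j y ∈ O.q i '' tsupport χ
    · obtain ⟨x', hx', he⟩ := hv
      obtain ⟨φ, W, W', hφ, hyW, rfl⟩ := exists_change_apply_eq hy (hNU (hsub hx')) he.symm
      refine (hχ.mul hh).contDiffAt.comp y (hφ.contDiffAt hyW) |>.congr_of_eventuallyEq ?_
      filter_upwards [hφ.isOpen.mem_nhds hyW,
        (hφ.contDiffAt hyW).continuousAt.eventually_mem (hNo.mem_nhds (hsub hx'))] with u hu huN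
      rw [← hφ.comp_eq u hu, hfN _ huN]
      rfl
    · refine contDiffAt_const (c := (0 : ℝ)) |>.congr_of_eventuallyEq ?_
      filter_upwards [((O.continuousOn_q j).continuousAt
        ((O.isOpen_U j).mem_nhds hy)).eventually_mem (hK.isOpen_compl.mem_nhds hv)]
        with u hu using hf0 _ hu
  refine ⟨⟨f, hsm⟩, ?_⟩
  filter_upwards [hone, hNo.mem_nhds hxN] with y hy hyN
  exact (hfN y hyN).trans (by rw [hy, one_mul])

/-- A continuous vector field on an open subset of a chart is determined by its action on the
smooth functions of the orbifold. -/
theorem eq_zero_of_forall_fderiv_eq_zero [T2Space V] {W : Set (Euc n)} (hW : IsOpen W)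
    (hWU : W ⊆ O.U i) {η : Euc n → Euc n} (hη : ContinuousOn η W)
    (h : ∀ (f : O.Fun), ∀ x ∈ W, fderiv ℝ (fun y => f (O.q i y)) x (η x) = 0) {x : Euc n}
    (hx : x ∈ W) : η x = 0 := by
  by_contra hne
  obtain ⟨y, hreg, hyW, hy⟩ := ((frequently_isRegular (hWU hx)).and_eventually
    ((hW.eventually_mem hx).and
      ((hη.continuousAt (hW.mem_nhds hx)).eventually_ne hne))).exists
  refine hy (PiLp.ext fun a => ?_)
  obtain ⟨f, hf⟩ := hreg.exists_fun_eventuallyEq (hWU hyW)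
    (EuclideanSpace.proj (𝕜 := ℝ) a : Euc n →L[ℝ] ℝ).contDiff
  have h1 := h f y hyW
  rw [hf.fderiv_eq, ContinuousLinearMap.fderiv] at h1
  exact h1

/-- A continuous map from the frame bundle of a chart to tangent vectors of the chart is determined
by its action on the smooth functions of the orbifold. -/
theorem eq_zero_on_frames_of_forall_fderiv_eq_zero [T2Space V] {η : FrameSpace n → Euc n}
    (hη : ContinuousOn η (O.frames i))
    (h : ∀ (f : O.Fun), ∀ z ∈ O.frames i, fderiv ℝ (fun y => f (O.q i y)) z.1 (η z) = 0)
    (hz : z ∈ O.frames i) : η z = 0 := by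
  have hd : ∀ x ∈ O.U i, ((x, z.2) : FrameSpace n) ∈ O.frameDomain i := fun x hx =>
    ⟨hx, (frames_subset_frameDomain hz).2⟩
  have hc : ContinuousOn (fun x => η (O.retract i (x, z.2))) (O.U i) :=
    hη.comp (contDiffOn_retract.continuousOn.comp
      (continuous_id.prodMk continuous_const).continuousOn hd)
      fun x hx => retract_mem_frames (hd x hx)
  have h1 := eq_zero_of_forall_fderiv_eq_zero (O.isOpen_U i) subset_rfl hc
    (fun f x hx => h f _ (retract_mem_frames (hd x hx))) hz.1
  simpa only [Prod.mk.eta, retract_eq_self hz] using h1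

/-! ### Smooth functions of the resolution -/

variable (O) in
/-- Smooth functions of the resolution. -/
abbrev ResFun : Type _ := SmoothFun O.resSmooth

open Classical in
/-- A function on the resolution in terms of the frames of the chart `U i`, extended by zero to all
of `FrameSpace n`. -/
def onFrames (G : O.Res → ℝ) (i : O.ι) (z : FrameSpace n) : ℝ :=
  if hz : z ∈ O.frames i then G (framePt i z hz) else 0

theorem onFrames_apply (G : O.Res → ℝ) (hz : z ∈ O.frames i) :
    onFrames G i z = G (framePt i z hz) := dif_pos hz

theorem mem_resSmooth_iff {G : O.Res → ℝ} :
    G ∈ O.resSmooth ↔ ∀ i, ContDiffOn ℝ ∞ (onFrames G i) (O.frames i) := by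
  refine ⟨fun h i => ?_, fun h i => ⟨_, h i, fun z => (onFrames_apply G z.2).symm⟩⟩
  obtain ⟨H, hH, he⟩ := h i
  exact hH.congr fun z hz => (onFrames_apply G hz).trans (he ⟨z, hz⟩)

theorem contDiffOn_onFrames (G : O.ResFun) (i : O.ι) :
    ContDiffOn ℝ ∞ (onFrames G i) (O.frames i) := mem_resSmooth_iff.1 G.2 i

theorem Change.onFrames_frameLift (h : O.Change i j φ W W') (G : O.Res → ℝ) (hz : z ∈ O.frames i)
    (hW : z.1 ∈ W) : onFrames G j (frameLift φ z) = onFrames G i z := by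
  rw [onFrames_apply G hz, onFrames_apply G (h.frameLift_mem hz hW), h.framePt_frameLift hz hW]

/-- The group `Γ i` acts freely on frames. -/
theorem Γ_eq_one_of_frameLift_eq {γ : Equiv.Perm (Euc n)} (hγ : γ ∈ O.Γ i) (hz : z ∈ O.frames i)
    (h : frameLift γ z = z) : γ = 1 := by
  refine Γ_eq_one_of_fderiv_eq_id hγ hz.1 (congrArg Prod.fst h) ?_
  have hli := (formOrthonormal_of_mem_frames hz).linearIndependent
  have hspan := hli.span_eq_top_of_card_eq_finrank' (by simp)
  refine ContinuousLinearMap.coe_injective (LinearMap.ext_on_range hspan fun a => ?_)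
  exact congrFun (congrArg Prod.snd h) a

/-- The points of the resolution that are not represented by a frame in the compact set `K` form an
open set. This is the Hausdorff property of the resolution, which comes from that of `V`. -/
theorem eventually_forall_framePt_ne [T2Space V] {K : Set (FrameSpace n)} (hK : IsCompact K)
    (hKd : K ⊆ O.frameDomain i) (hw : w ∈ O.frames j)
    (hne : ∀ z ∈ K, ∀ hz : z ∈ O.frames i, framePt i z hz ≠ framePt j w hw) :
    ∀ᶠ u in 𝓝 w, ∀ hu : u ∈ O.frames j, ∀ z ∈ K, ∀ hz : z ∈ O.frames i,
      framePt i z hz ≠ framePt j u hu := by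
  by_contra hcon
  set S : Set (FrameSpace n) := {u | ∃ z ∈ K, ∃ (hz : z ∈ O.frames i) (hu : u ∈ O.frames j),
    framePt i z hz = framePt j u hu} with hS
  have hfr : ∃ᶠ u in 𝓝 w, u ∈ S := fun h => hcon (h.mono fun u hu hu' z hzK hz he =>
    hu ⟨z, hzK, hz, hu', he⟩)
  have : NeBot (𝓝 w ⊓ 𝓟 S) := frequently_mem_iff_neBot.1 hfr
  set l := Ultrafilter.of (𝓝 w ⊓ 𝓟 S) with hl
  have hlw : (l : Filter (FrameSpace n)) ≤ 𝓝 w := (Ultrafilter.of_le _).trans inf_le_left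
  have hlS : S ∈ l := le_principal_iff.1 ((Ultrafilter.of_le (𝓝 w ⊓ 𝓟 S)).trans inf_le_right)
  -- Along the ultrafilter `l` the frames in `K` converge to some `z`.
  choose! F hF using fun (u : FrameSpace n) (hu : u ∈ S) => hu
  replace hF := Filter.mem_of_superset hlS hF
  obtain ⟨z, hzK, hz⟩ := hK.ultrafilter_le_nhds (l.map F)
    (le_principal_iff.2 (Ultrafilter.mem_map.2
      (Filter.mem_of_superset hF fun u hu => hu.1)))
  replace hz : Tendsto F l (𝓝 z) := hz
  have hzf : z ∈ O.frames i := by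
    have hr : ContinuousAt (O.retract i) z :=
      contDiffOn_retract.continuousOn.continuousAt ((O.isOpen_frameDomain i).mem_nhds (hKd hzK))
    have h1 : Tendsto F l (𝓝 (O.retract i z)) := (hr.tendsto.comp hz).congr' (by
      filter_upwards [hF] with u hu using retract_eq_self hu.2.1)
    rw [tendsto_nhds_unique hz h1]
    exact retract_mem_frames (hKd hzK)
  have hq : O.q j w.1 = O.q i z.1 := by
    have h1 : Tendsto (fun u : FrameSpace n => O.q j u.1) l (𝓝 (O.q j w.1)) :=
      (((O.continuousOn_q j).continuousAt ((O.isOpen_U j).mem_nhds hw.1)).comp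
        continuousAt_fst).tendsto.mono_left hlw
    have h2 : Tendsto (fun u => O.q i (F u).1) l (𝓝 (O.q i z.1)) :=
      (((O.continuousOn_q i).continuousAt ((O.isOpen_U i).mem_nhds hzf.1)).comp
        continuousAt_fst).tendsto.comp hz
    refine tendsto_nhds_unique h1 (h2.congr' ?_)
    filter_upwards [hF] with u ⟨_, _, _, hu⟩
    exact congrArg O.proj hu
  obtain ⟨φ, W, W', hφ, hwW, hφw⟩ := exists_change_apply_eq hw.1 hzf.1 hq
  have := O.finite_Γ i
  have hγ : ∃ γ : O.Γ i, ∀ᶠ u in (l : Filter (FrameSpace n)),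
      frameLift γ.1 (frameLift φ u) = F u := by
    rw [← Ultrafilter.eventually_exists_iff]
    filter_upwards [hF, hlw (continuousAt_fst.eventually_mem (hφ.isOpen.mem_nhds hwW))]
      with u ⟨_, hu1, hu2, hu⟩ huW
    rw [← hφ.framePt_frameLift hu2 huW] at hu
    obtain ⟨γ, hγ, he⟩ := exists_Γ_of_framePt_eq_framePt hu.symm
    exact ⟨⟨γ, hγ⟩, he⟩
  obtain ⟨⟨γ, hγ⟩, he⟩ := hγ
  have hφU : φ w.1 ∈ O.U i := hφ.apply_mem hwW
  have hlim : Tendsto F l (𝓝 (frameLift γ (frameLift φ w))) := by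
    have h1 : ContinuousAt (fun u => frameLift γ (frameLift φ u)) w :=
      ContinuousAt.comp (g := frameLift γ)
        (contDiffAt_frameLift (Γ_contDiffAt hγ hφU)).continuousAt
        (contDiffAt_frameLift (hφ.contDiffAt hwW)).continuousAt
    exact (h1.tendsto.mono_left hlw).congr' he
  obtain rfl := tendsto_nhds_unique hz hlim
  refine hne _ hzK hzf ?_
  rw [← hφ.framePt_frameLift hw hwW]
  exact (Γ_change hγ).framePt_frameLift (hφ.frameLift_mem hw hwW) hφU

/-- Near a frame, every smooth function comes from a smooth function of the resolution, which can be
chosen with support in any given neighbourhood. -/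
theorem exists_resFun_eventuallyEq [T2Space V] (hz : z ∈ O.frames i) {N : Set (FrameSpace n)}
    (hN : N ∈ 𝓝 z) {h : FrameSpace n → ℝ} (hh : ContDiff ℝ ∞ h) :
    ∃ G : O.ResFun, (∀ᶠ u in 𝓝 z, u ∈ O.frames i → onFrames G i u = h u) ∧
      ∀ ρ, G ρ ≠ 0 → ∃ u ∈ N, ∃ hu : u ∈ O.frames i, framePt i u hu = ρ := by
  classical
  have := O.finite_Γ i
  obtain ⟨M, hMN, hMo, hzM, hM⟩ := exists_isOpen_forall_notMem
    (κ := {γ : O.Γ i // γ ≠ 1}) (f := fun γ => frameLift γ.1.1)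
    (inter_mem hN ((O.isOpen_frameDomain i).mem_nhds (frames_subset_frameDomain hz)))
    (fun γ => (contDiffAt_frameLift (Γ_contDiffAt γ.1.2 hz.1)).continuousAt)
    fun γ hγ => γ.2 (Subtype.ext (Γ_eq_one_of_frameLift_eq γ.1.2 hz hγ))
  have hinj : ∀ u ∈ M, ∀ u' ∈ M, ∀ (hu : u ∈ O.frames i) (hu' : u' ∈ O.frames i),
      framePt i u hu = framePt i u' hu' → u = u' := fun u huM u' huM' hu hu' he => by
    obtain ⟨γ, hγ, rfl⟩ := exists_Γ_of_framePt_eq_framePt he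
    by_cases h1 : γ = 1
    · rw [h1]
      exact (frameLift_id u).symm
    · exact absurd huM' (hM ⟨⟨γ, hγ⟩, fun h2 => h1 (congrArg Subtype.val h2)⟩ u huM)
  obtain ⟨χ, hχ, hcs, hsub, hone⟩ := exists_bump (hMo.mem_nhds hzM)
  -- The function `χ h`, transported to the image of `M` and extended by zero.
  set G : O.Res → ℝ := fun ρ => if hρ : ∃ u ∈ M, ∃ hu : u ∈ O.frames i, framePt i u hu = ρ then
    χ hρ.choose * h hρ.choose else 0 with hG
  have hGM : ∀ u ∈ M, ∀ hu : u ∈ O.frames i, G (framePt i u hu) = χ u * h u := fun u huM hu => by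
    have hρ : ∃ u' ∈ M, ∃ hu' : u' ∈ O.frames i, framePt i u' hu' = framePt i u hu :=
      ⟨u, huM, hu, rfl⟩
    rw [hG]
    simp only [dif_pos hρ]
    rw [hinj _ hρ.choose_spec.1 u huM hρ.choose_spec.2.choose hu hρ.choose_spec.2.choose_spec]
  have hG0 : ∀ ρ, (∀ u ∈ tsupport χ, ∀ hu : u ∈ O.frames i, framePt i u hu ≠ ρ) → G ρ = 0 :=
    fun ρ hρ => by
    by_cases h1 : ∃ u ∈ M, ∃ hu : u ∈ O.frames i, framePt i u hu = ρ
    · obtain ⟨u, huM, hu, rfl⟩ := h1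
      rw [hGM u huM hu, image_eq_zero_of_notMem_tsupport fun h2 => hρ u h2 hu rfl, zero_mul]
    · rw [hG]
      simp only [dif_neg h1]
  have hsm : G ∈ O.resSmooth := mem_resSmooth_iff.2 fun j w hw => by
    by_cases hex : ∃ u ∈ tsupport χ, ∃ hu : u ∈ O.frames i, framePt i u hu = framePt j w hw
    · obtain ⟨u, huK, hu, he⟩ := hex
      obtain ⟨φ, W, W', hφ, hwW, rfl⟩ := framePt_eq_framePt_iff.1 he.symm
      have hlift := contDiffAt_frameLift (hφ.contDiffAt hwW)
      refine ((hχ.mul hh).contDiffAt.comp w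
        hlift).contDiffWithinAt.congr_of_eventuallyEq_of_mem ?_ hw
      filter_upwards [self_mem_nhdsWithin, mem_nhdsWithin_of_mem_nhds
        (continuousAt_fst.eventually_mem (hφ.isOpen.mem_nhds hwW)), mem_nhdsWithin_of_mem_nhds
        (hlift.continuousAt.eventually_mem (hMo.mem_nhds (hsub huK)))] with v hv hvW hvM
      rw [← hφ.onFrames_frameLift G hv hvW, onFrames_apply G (hφ.frameLift_mem hv hvW),
        hGM _ hvM]
      rfl
    · push Not at hex
      refine (contDiffWithinAt_const (c := (0 : ℝ))).congr_of_eventuallyEq_of_mem ?_ hw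
      filter_upwards [self_mem_nhdsWithin, mem_nhdsWithin_of_mem_nhds
        (eventually_forall_framePt_ne hcs
          (hsub.trans (hMN.trans inter_subset_right)) hw hex)] with v hv hvne
      rw [onFrames_apply G hv, hG0 _ (hvne hv)]
  refine ⟨⟨G, hsm⟩, ?_, fun ρ hρ => ?_⟩
  · filter_upwards [hone, hMo.mem_nhds hzM] with u hu huM huf
    rw [onFrames_apply _ huf]
    exact (hGM u huM huf).trans (by rw [hu, one_mul])
  · by_contra hcon
    push Not at hcon
    exact hρ (hG0 ρ fun u hu => hcon u (hMN (hsub hu)).1)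

end RiemannianOrbifold

/-- Evaluation of smooth functions at a point. -/
def SmoothFun.eval {M : Type*} {B : Subalgebra ℝ (M → ℝ)} (x : M) : SmoothFun B →ₐ[ℝ] ℝ :=
  (Pi.evalAlgHom ℝ (fun _ : M => ℝ) x).comp B.val

theorem SmoothFun.eval_apply {M : Type*} {B : Subalgebra ℝ (M → ℝ)} (x : M) (f : SmoothFun B) :
    SmoothFun.eval x f = f x := rfl

namespace RiemannianOrbifold

variable {n : ℕ} {V : Type*} [TopologicalSpace V] {O : RiemannianOrbifold n V} {i j k : O.ι}
  {φ : Euc n → Euc n} {W W' : Set (Euc n)} {z w : FrameSpace n}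

/-! ### Derivations of the functions of the resolution -/

/-- Derivations are local: a function that vanishes near a point has product zero with some bump
function at this point. -/
theorem derivation_congr [T2Space V] (Z : Foliated.VF O.resSmooth) {G G' : O.ResFun}
    (hz : z ∈ O.frames i)
    (h : ∀ᶠ u in 𝓝 z, u ∈ O.frames i → onFrames G i u = onFrames G' i u) :
    onFrames (Z G) i z = onFrames (Z G') i z := by
  obtain ⟨χ, hone, hsupp⟩ := exists_resFun_eventuallyEq hz h (h := fun _ => 1) contDiff_const
  have h0 : χ * (G - G') = 0 := by
    ext ρ
    by_cases hρ : χ ρ = 0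
    · simp [hρ]
    · obtain ⟨u, hu, huf, rfl⟩ := hsupp ρ hρ
      have := hu huf
      rw [onFrames_apply _ huf, onFrames_apply _ huf] at this
      simp [this]
  have h1 := hone.self_of_nhds hz
  have h2 := h.self_of_nhds hz
  rw [onFrames_apply _ hz] at h1
  rw [onFrames_apply _ hz, onFrames_apply _ hz] at h2 ⊢
  have h3 := congrArg (SmoothFun.eval (framePt i z hz)) (congrArg Z h0)
  rw [Derivation.leibniz, map_zero, map_zero, map_add, smul_eq_mul, smul_eq_mul, map_mul, map_mul,
    map_sub, map_sub, map_sub] at h3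
  simp only [SmoothFun.eval_apply, h1, h2] at h3
  linarith

/-- The extension of a function on the resolution, in terms of the frames of the chart `U i`, to
all bases, along the Gram–Schmidt retraction. -/
def ambient (G : O.Res → ℝ) (i : O.ι) (z : FrameSpace n) : ℝ := onFrames G i (O.retract i z)

theorem ambient_eq_onFrames (G : O.Res → ℝ) (hz : z ∈ O.frames i) :
    ambient G i z = onFrames G i z := by
  rw [ambient, retract_eq_self hz]

theorem contDiffAt_ambient (G : O.ResFun) (hz : z ∈ O.frameDomain i) :
    ContDiffAt ℝ ∞ (ambient G i) z :=
  ((contDiffOn_onFrames G i).comp contDiffOn_retract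
    fun _ hu => retract_mem_frames hu).contDiffAt ((O.isOpen_frameDomain i).mem_nhds hz)

theorem contDiffOn_ambient (G : O.ResFun) : ContDiffOn ℝ ∞ (ambient G i) (O.frameDomain i) :=
  fun _ hz => (contDiffAt_ambient G hz).contDiffWithinAt

/-- In the frame bundle of a chart, a vector field `Z` of the resolution is given by the smooth
vector field `ζ` of the surrounding space. -/
def IsFrameForm (Z : Foliated.VF O.resSmooth) (i : O.ι) (ζ : FrameSpace n → FrameSpace n) : Prop :=
  ContDiffOn ℝ ∞ ζ (O.frames i) ∧ ∀ (G : O.ResFun), ∀ z ∈ O.frames i,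
    onFrames (Z G) i z = fderiv ℝ (ambient G i) z (ζ z)

/-- Every derivation is given by a smooth vector field on the frame bundle. The components of `ζ` at
`z` are the derivatives of functions extending the linear coordinates of `FrameSpace n` near `z`. -/
theorem exists_isFrameForm [T2Space V] (Z : Foliated.VF O.resSmooth) (i : O.ι) :
    ∃ ζ, IsFrameForm Z i ζ := by
  classical
  set b := Module.finBasis ℝ (FrameSpace n) with hb
  set x : Fin _ → FrameSpace n →L[ℝ] ℝ := fun k => (b.coord k).toContinuousLinearMap with hx
  have hsum : ∀ v, ∑ k, x k v • b k = v := fun v => b.sum_repr v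
  choose c hc hc' using fun (z : FrameSpace n) (hz : z ∈ O.frames i) k =>
    exists_resFun_eventuallyEq hz univ_mem (x k).contDiff
  set ζ : FrameSpace n → FrameSpace n := fun z =>
    if hz : z ∈ O.frames i then ∑ k, onFrames (Z (c z hz k)) i z • b k else 0 with hζ
  refine ⟨ζ, fun z hz => ?_, fun G z hz => ?_⟩
  · -- By locality, near `z` the coordinate functions chosen at `z` may be used.
    have h1 : ContDiffWithinAt ℝ ∞ (fun u => ∑ k, onFrames (Z (c z hz k)) i u • b k)
        (O.frames i) z :=
      ContDiffWithinAt.sum fun k _ => (contDiffOn_onFrames _ i z hz).smul contDiffWithinAt_const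
    refine h1.congr_of_eventuallyEq_of_mem ?_ hz
    have h2 : ∀ᶠ u in 𝓝 z, ∀ k, ∀ᶠ v in 𝓝 u, v ∈ O.frames i → onFrames (c z hz k) i v = x k v :=
      eventually_all.2 fun k => (hc z hz k).eventually_nhds
    filter_upwards [self_mem_nhdsWithin, mem_nhdsWithin_of_mem_nhds h2] with u hu hu2
    rw [hζ]
    simp only [dif_pos hu]
    refine Finset.sum_congr rfl fun k _ => ?_
    rw [derivation_congr Z hu]
    filter_upwards [hc u hu k, hu2 k] with v hv hv2 hvf
    rw [hv hvf, hv2 hvf]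
  · have hzd := frames_subset_frameDomain hz
    obtain ⟨h, hh, hhe⟩ := exists_contDiff_eventuallyEq (O.isOpen_frameDomain i) hzd
      (contDiffOn_ambient G)
    obtain ⟨D, hD, hDz, hDh⟩ := exists_contDiff_eq_add_apply_sub hh z
    choose H hH hH' using fun k => exists_resFun_eventuallyEq (h := fun w => D w (b k)) hz univ_mem
      (hD.clm_apply contDiff_const)
    set p := framePt i z hz with hp
    -- Near `z`, the function `G` equals `h(z) + ∑ (x_k - x_k(z)) H_k`.
    have hG : onFrames (Z G) i z = onFrames (Z (algebraMap ℝ O.ResFun (h z) +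
        ∑ k, (c z hz k - algebraMap ℝ O.ResFun (x k z)) * H k)) i z := by
      refine derivation_congr Z hz ?_
      filter_upwards [hhe, eventually_all.2 (hc z hz), eventually_all.2 hH] with u hu huc huH huf
      have hexp : D u (u - z) = ∑ k, x k (u - z) * D u (b k) := by
        conv_lhs => rw [← hsum (u - z), map_sum]
        simp only [map_smul, smul_eq_mul]
      rw [← ambient_eq_onFrames _ huf, ← hu, hDh u, hexp, onFrames_apply _ huf,
        ← SmoothFun.eval_apply]
      simp only [map_add, map_sum, map_mul, map_sub, AlgHom.commutes]
      simp only [SmoothFun.eval_apply]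
      congr 1
      refine Finset.sum_congr rfl fun k _ => ?_
      have h1 := huc k huf
      have h2 := huH k huf
      rw [onFrames_apply _ huf] at h1 h2
      rw [h1, h2]
      rfl
    rw [hG, onFrames_apply _ hz, hζ]
    simp only [dif_pos hz]
    change SmoothFun.eval p _ = _
    simp only [map_add, map_sum, Derivation.leibniz, map_sub, Derivation.map_algebraMap,
      smul_eq_mul, map_mul, AlgHom.commutes, sub_zero, zero_add, map_smul]
    refine Finset.sum_congr rfl fun k _ => ?_
    have h1 := (hc z hz k).self_of_nhds hz
    have h2 := (hH k).self_of_nhds hz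
    rw [onFrames_apply _ hz] at h1 h2 ⊢
    simp only [SmoothFun.eval_apply]
    rw [← hp] at h1 h2 ⊢
    rw [h1, h2, hDz, hhe.fderiv_eq]
    simp
    ring

/-! ### Foliated functions -/

variable (O) in
theorem proj_surjective : Function.Surjective O.proj := fun v => by
  obtain ⟨i, x, hx, rfl⟩ := O.cover v
  exact ⟨framePt i _ (frameSection_mem_frames hx), rfl⟩

theorem pullback_apply (f : O.Fun) (ρ : O.Res) : (O.pullback f).1 ρ = f (O.proj ρ) := rfl

theorem onFrames_pullback (f : O.Fun) (hz : z ∈ O.frames i) :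
    onFrames (O.pullback f).1 i z = f (O.q i z.1) := onFrames_apply _ hz

variable (O) in
/-- The pullback of functions as a homomorphism of algebras. -/
def pullbackHom : O.Fun →ₐ[ℝ] O.FolFun where
  toFun := O.pullback
  map_one' := rfl
  map_mul' _ _ := rfl
  map_zero' := rfl
  map_add' _ _ := rfl
  commutes' _ := rfl

theorem pullback_injective : Function.Injective O.pullback := fun f g h => by
  ext v
  obtain ⟨ρ, rfl⟩ := O.proj_surjective v
  rw [← pullback_apply, h, pullback_apply]

theorem pullback_surjective : Function.Surjective O.pullback := fun F => by
  have hF : ∀ ρ σ, O.proj ρ = O.proj σ → F.1 ρ = F.1 σ := F.2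
  set f : V → ℝ := fun v => F.1 (O.proj_surjective v).choose with hf
  have hfp : ∀ ρ, f (O.proj ρ) = F.1 ρ := fun ρ => hF _ _ (O.proj_surjective (O.proj ρ)).choose_spec
  have hsm : O.IsSmooth f := O.isSmooth_of_forall fun i => by
    refine ((contDiffOn_onFrames F.1 i).comp contDiffOn_frameSection
      fun x hx => frameSection_mem_frames hx).congr fun x hx => ?_
    rw [Function.comp_apply, onFrames_apply _ (frameSection_mem_frames hx), ← hfp]
    rfl
  exact ⟨⟨f, hsm⟩, Subtype.ext (SmoothFun.ext hfp)⟩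

variable (O) in
/-- Foliated functions of the resolution are the same as smooth functions of the orbifold. -/
def pullbackEquiv : O.Fun ≃ₐ[ℝ] O.FolFun :=
  AlgEquiv.ofBijective O.pullbackHom ⟨pullback_injective, pullback_surjective⟩

theorem fderiv_ambient_pullback (f : O.Fun) (hz : z ∈ O.frames i) (v : FrameSpace n) :
    fderiv ℝ (ambient (O.pullback f).1 i) z v = fderiv ℝ (fun y => f (O.q i y)) z.1 v.1 := by
  have h : ambient (O.pullback f).1 i =ᶠ[𝓝 z] (fun y => f (O.q i y)) ∘ Prod.fst := by
    filter_upwards [(O.isOpen_frameDomain i).mem_nhds (frames_subset_frameDomain hz)] with u hu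
    exact onFrames_pullback f (retract_mem_frames hu)
  rw [h.fderiv_eq, fderiv_comp z (differentiableAt_fun f hz.1) differentiableAt_fst, fderiv_fst]
  rfl

/-! ### Vector fields of the resolution along the orbifold -/

/-- In the chart `U i`, the vector field `Z` of the resolution is mapped to `η` by the differential
of the projection. -/
def IsBaseForm (Z : Foliated.VF O.resSmooth) (i : O.ι) (η : FrameSpace n → Euc n) : Prop :=
  ContDiffOn ℝ ∞ η (O.frames i) ∧ ∀ (f : O.Fun), ∀ z ∈ O.frames i,
    onFrames (Z (O.pullback f).1) i z = fderiv ℝ (fun y => f (O.q i y)) z.1 (η z)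

theorem IsFrameForm.isBaseForm {Z : Foliated.VF O.resSmooth} {ζ : FrameSpace n → FrameSpace n}
    (h : IsFrameForm Z i ζ) : IsBaseForm Z i fun z => (ζ z).1 :=
  ⟨contDiff_fst.comp_contDiffOn h.1, fun f z hz => by
    rw [h.2 _ z hz, fderiv_ambient_pullback f hz]⟩

/-- The projection of a vector field of the resolution is determined by the action of this field on
the pullbacks of functions. -/
theorem IsBaseForm.eq_of_forall [T2Space V] {Z : Foliated.VF O.resSmooth} {η : FrameSpace n → Euc n}
    (h : IsBaseForm Z i η) {η' : FrameSpace n → Euc n} (hη' : ContinuousOn η' (O.frames i))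
    (h' : ∀ (f : O.Fun), ∀ z ∈ O.frames i,
      onFrames (Z (O.pullback f).1) i z = fderiv ℝ (fun y => f (O.q i y)) z.1 (η' z))
    (hz : z ∈ O.frames i) : η z = η' z :=
  sub_eq_zero.1 (eq_zero_on_frames_of_forall_fderiv_eq_zero (η := fun z => η z - η' z)
    (h.1.continuousOn.sub hη') (fun f u hu => by rw [map_sub, ← h.2 f u hu, h' f u hu, sub_self])
    hz)

theorem act_mk (Z : Foliated.adapted O.resSmooth O.fol) (F : O.FolFun) :
    (Foliated.Vect.act (Submodule.Quotient.mk Z : O.FolVect) F).1 = Z.1 F.1 := rfl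

section T2

variable [T2Space V]

/-- A frame form of the vector field `Z` of the resolution. -/
def frameForm (Z : Foliated.VF O.resSmooth) (i : O.ι) : FrameSpace n → FrameSpace n :=
  (exists_isFrameForm Z i).choose

theorem isFrameForm_frameForm (Z : Foliated.VF O.resSmooth) (i : O.ι) :
    IsFrameForm Z i (frameForm Z i) := (exists_isFrameForm Z i).choose_spec

/-- The image of the vector field `Z` of the resolution under the differential of the projection,
in the chart `U i`. -/
def baseForm (Z : Foliated.VF O.resSmooth) (i : O.ι) (z : FrameSpace n) : Euc n :=
  (frameForm Z i z).1

theorem isBaseForm_baseForm (Z : Foliated.VF O.resSmooth) (i : O.ι) :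
    IsBaseForm Z i (baseForm Z i) := (isFrameForm_frameForm Z i).isBaseForm

theorem baseForm_eq_zero {Z : Foliated.VF O.resSmooth} (hZ : ∀ f, Z (O.pullback f).1 = 0)
    (hz : z ∈ O.frames i) : baseForm Z i z = 0 :=
  (isBaseForm_baseForm Z i).eq_of_forall (η' := fun _ => 0) continuousOn_const (fun f u hu => by
    rw [hZ, onFrames_apply _ hu, map_zero]
    rfl) hz

/-- A vector field of the resolution is tangent to the leaves if and only if it kills the pullbacks
of functions. -/
theorem mem_tangent_iff {Z : Foliated.VF O.resSmooth} :
    Z ∈ Foliated.tangent O.resSmooth O.fol ↔ ∀ f, Z (O.pullback f).1 = 0 := by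
  refine ⟨fun h f => Foliated.tangent_apply_eq_zero h (O.pullback f).2, fun h ρ G hG σ hσ => ?_⟩
  obtain ⟨i, z, hz, rfl⟩ := exists_framePt_eq σ
  refine (onFrames_apply (Z G).1 hz).symm.trans ?_
  rw [(isFrameForm_frameForm Z i).2 G z hz]
  have hd := frames_subset_frameDomain hz
  -- `G` vanishes on the fibre through `z`, and `Z` is tangent to this fibre.
  have h1 : frameForm Z i z = ContinuousLinearMap.inr ℝ (Euc n) _ (frameForm Z i z).2 :=
    Prod.ext (baseForm_eq_zero h hz) rfl
  have h2 : (fun A => ambient G i (z.1, A)) =ᶠ[𝓝 z.2] fun _ => 0 := by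
    filter_upwards [isOpen_setOfPred_linearIndependent.mem_nhds hd.2] with A hA
    have hA' := retract_mem_frames (z := (z.1, A)) ⟨hz.1, hA⟩
    rw [ambient, onFrames_apply _ hA']
    exact hG _ hσ
  have h3 : HasFDerivAt (fun A => ambient G i (z.1, A))
      ((fderiv ℝ (ambient G i) z).comp (ContinuousLinearMap.inr ℝ (Euc n) _)) z.2 :=
    HasFDerivAt.comp (g := ambient G i) z.2
      ((contDiffAt_ambient G hd).differentiableAt (by simp)).hasFDerivAt
      (hasFDerivAt_prodMk_right z.1 z.2)
  rw [h1, ← ContinuousLinearMap.comp_apply, ← h3.fderiv, h2.fderiv_eq]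
  simp

/-- The condition on brackets with `Γ(TF)` is automatic for fields acting on foliated functions,
because `Γ(TF)` consists of the fields that kill them. -/
theorem mem_adapted_of_forall {Z : Foliated.VF O.resSmooth}
    (h : ∀ F ∈ Foliated.basic O.resSmooth O.fol, Z F ∈ Foliated.basic O.resSmooth O.fol) :
    Z ∈ Foliated.adapted O.resSmooth O.fol := by
  refine ⟨fun Y hY => mem_tangent_iff.2 fun f => ?_, h⟩
  rw [Derivation.commutator_apply, mem_tangent_iff.1 hY, map_zero,
    Foliated.tangent_apply_eq_zero hY (h _ (O.pullback f).2), sub_zero]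

/-- A foliated vector field is determined by its action on the pullbacks of functions. -/
theorem act_injective {Z Z' : O.FolVect}
    (h : ∀ f, Foliated.Vect.act Z (O.pullback f) = Foliated.Vect.act Z' (O.pullback f)) :
    Z = Z' := by
  obtain ⟨Z, rfl⟩ := Submodule.Quotient.mk_surjective _ Z
  obtain ⟨Z', rfl⟩ := Submodule.Quotient.mk_surjective _ Z'
  rw [Submodule.Quotient.eq]
  refine mem_tangent_iff.2 fun f => ?_
  have h1 : Z.1 (O.pullback f).1 = Z'.1 (O.pullback f).1 := congrArg Subtype.val (h f)
  change (Z.1 - Z'.1) _ = 0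
  rw [Derivation.sub_apply, h1, sub_self]

/-- Every foliated vector field comes from a vector field of the orbifold: its local form is the
image of `Z` under the differential of the projection, along a section of the frame bundle. -/
theorem exists_vect_of_folVect (Z : O.FolVect) : ∃ X : O.Vect, ∀ f,
    Foliated.Vect.act Z (O.pullback f) = O.pullback (X.1 f) := by
  set D : Derivation ℝ O.Fun O.Fun := Derivation.mk'
    (O.pullbackEquiv.symm.toLinearMap ∘ₗ (Foliated.Vect.act Z).toLinearMap ∘ₗ
      O.pullbackEquiv.toLinearMap) (fun f g => by
        refine O.pullbackEquiv.injective ?_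
        simp [Derivation.leibniz]) with hD
  have hDf : ∀ f, Foliated.Vect.act Z (O.pullback f) = O.pullback (D f) := fun f =>
    (O.pullbackEquiv.apply_symm_apply _).symm
  refine ⟨⟨D, fun i => ?_⟩, hDf⟩
  obtain ⟨Z, rfl⟩ := Submodule.Quotient.mk_surjective _ Z
  have hb := isBaseForm_baseForm Z.1 i
  refine ⟨fun x => baseForm Z.1 i (O.frameSection i x),
    hb.1.comp contDiffOn_frameSection fun x hx => frameSection_mem_frames hx, fun f x hx => ?_⟩
  have hs := frameSection_mem_frames hx
  have h1 := hb.2 f _ hs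
  rw [← act_mk, hDf, onFrames_pullback _ hs] at h1
  exact h1

end T2

/-! ### Lifting vector fields to the resolution -/

theorem Change.fderiv_comp_q (h : O.Change i j φ W W') (f : O.Fun) {x : Euc n} (hx : x ∈ W)
    (v : Euc n) : fderiv ℝ (fun y => f (O.q i y)) x v =
      fderiv ℝ (fun y => f (O.q j y)) (φ x) (fderiv ℝ φ x v) := by
  have h1 : (fun y => f (O.q i y)) =ᶠ[𝓝 x] (fun y => f (O.q j y)) ∘ φ := by
    filter_upwards [h.isOpen.mem_nhds hx] with y hy
    rw [Function.comp_apply, h.comp_eq y hy]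
  rw [h1.fderiv_eq, fderiv_comp x (differentiableAt_fun f (h.apply_mem hx)) (h.differentiableAt hx)]
  rfl

/-- Vectors at a regular point that act in the same way on the functions of the orbifold
correspond to each other under changes of charts. -/
theorem IsRegular.fderiv_apply_eq [T2Space V] {x : Euc n} (hreg : O.IsRegular i x)
    (h : O.Change i j φ W W') (hx : x ∈ W) {v w : Euc n}
    (hvw : ∀ f : O.Fun, fderiv ℝ (fun y => f (O.q i y)) x v =
      fderiv ℝ (fun y => f (O.q j y)) (φ x) w) : fderiv ℝ φ x v = w := by
  obtain ⟨u, rfl⟩ := h.fderiv_surjective hx w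
  congr 1
  refine PiLp.ext fun a => ?_
  obtain ⟨f, hf⟩ := hreg.exists_fun_eventuallyEq (h.subset hx)
    (EuclideanSpace.proj (𝕜 := ℝ) a : Euc n →L[ℝ] ℝ).contDiff
  have h1 := hvw f
  rw [← h.fderiv_comp_q f hx, hf.fderiv_eq, ContinuousLinearMap.fderiv] at h1
  exact h1

/-- The local forms of an operator on functions in two charts are related by the change of charts,
by density of the regular points. -/
theorem Change.fderiv_localForm [T2Space V] (h : O.Change i j φ W W') {X : O.Fun → O.Fun}
    {ξ ξ' : Euc n → Euc n} (hξ : O.IsLocalForm X i ξ) (hξ' : O.IsLocalForm X j ξ') {x : Euc n}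
    (hx : x ∈ W) : fderiv ℝ φ x (ξ x) = ξ' (φ x) := by
  have hc1 : ContinuousAt (fun y => fderiv ℝ φ y (ξ y)) x :=
    ((h.contDiffAt hx).fderiv_right (m := ∞) (by simp)).continuousAt.clm_apply
      (hξ.1.continuousOn.continuousAt ((O.isOpen_U i).mem_nhds (h.subset hx)))
  have hc2 : ContinuousAt (fun y => ξ' (φ y)) x :=
    ContinuousAt.comp (g := ξ')
      (hξ'.1.continuousOn.continuousAt ((O.isOpen_U j).mem_nhds (h.apply_mem hx)))
      (h.contDiffAt hx).continuousAt
  by_contra hne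
  obtain ⟨y, hreg, hyW, hy⟩ := ((frequently_isRegular (h.subset hx)).and_eventually
    ((h.isOpen.eventually_mem hx).and
      ((hc1.prodMk hc2).eventually_mem ((isOpen_ne_fun continuous_fst continuous_snd).mem_nhds
        hne)))).exists
  refine hy (hreg.fderiv_apply_eq h hyW fun f => ?_)
  rw [← hξ.2 f y (h.subset hyW), ← hξ'.2 f _ (h.apply_mem hyW), h.comp_eq y hyW]

/-- The Gram–Schmidt extensions correspond to each other under the lift of a change of charts, also
on bases that are not orthonormal. -/
theorem Change.ambient_frameLift (h : O.Change i j φ W W') (G : O.Res → ℝ)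
    (hz : z ∈ O.frameDomain i) (hW : z.1 ∈ W) : ambient G j (frameLift φ z) = ambient G i z := by
  rw [ambient, h.retract_frameLift hW, ambient, h.onFrames_frameLift G (retract_mem_frames hz) hW]

theorem Change.frameLift_mem_frameDomain (h : O.Change i j φ W W') (hz : z ∈ O.frameDomain i)
    (hW : z.1 ∈ W) : frameLift φ z ∈ O.frameDomain j :=
  ⟨h.apply_mem hW, hz.2.map' (fderiv ℝ φ z.1).toLinearMap
    (LinearMap.ker_eq_bot.2 (h.fderiv_injective hW))⟩

/-- If `dφ ∘ ξ = ξ' ∘ φ`, then the lifts `(x, A) ↦ (ξ(x), dξ_x A)` are related in the same way by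
the lift of `φ`; here the symmetry of the second derivative of `φ` enters. -/
theorem fderiv_frameLift_frameLift {ξ ξ' : Euc n → Euc n} (hφ : ContDiffAt ℝ ∞ φ z.1)
    (hξ : DifferentiableAt ℝ ξ z.1) (hξ' : DifferentiableAt ℝ ξ' (φ z.1))
    (h : ∀ᶠ y in 𝓝 z.1, fderiv ℝ φ y (ξ y) = ξ' (φ y)) :
    fderiv ℝ (frameLift φ) z (frameLift ξ z) = frameLift ξ' (frameLift φ z) := by
  have hd := hφ.differentiableAt (by simp)
  have hdd : DifferentiableAt ℝ (fderiv ℝ φ) z.1 :=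
    (hφ.fderiv_right (m := ∞) (by simp)).differentiableAt (by simp)
  have h1 : HasFDerivAt (fun u : FrameSpace n => φ u.1)
      ((fderiv ℝ φ z.1).comp (ContinuousLinearMap.fst ℝ _ _)) z :=
    hd.hasFDerivAt.comp z hasFDerivAt_fst
  have h0 : ∀ a, HasFDerivAt (fun u : FrameSpace n => u.2 a)
      ((ContinuousLinearMap.proj a).comp (ContinuousLinearMap.snd ℝ (Euc n) (Fin n → Euc n))) z :=
    fun a => HasFDerivAt.comp (g := fun A : Fin n → Euc n => A a) (f := Prod.snd) z
      (hasFDerivAt_apply a z.2) hasFDerivAt_snd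
  have h2 : ∀ a, HasFDerivAt (fun u : FrameSpace n => fderiv ℝ φ u.1 (u.2 a))
      ((fderiv ℝ φ z.1).comp ((ContinuousLinearMap.proj a).comp (ContinuousLinearMap.snd ℝ _ _)) +
        ((fderiv ℝ (fderiv ℝ φ) z.1).comp (ContinuousLinearMap.fst ℝ _ _)).flip (z.2 a)) z :=
    fun a => HasFDerivAt.clm_apply (c := fun u : FrameSpace n => fderiv ℝ φ u.1)
      (u := fun u : FrameSpace n => u.2 a)
      (hdd.hasFDerivAt.comp z hasFDerivAt_fst)
      (h0 a)
  have h3 : HasFDerivAt (frameLift φ) _ z := h1.prodMk (hasFDerivAt_pi.2 h2)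
  have hsymm : IsSymmSndFDerivAt ℝ φ z.1 :=
    hφ.isSymmSndFDerivAt (by
      rw [minSmoothness_of_isRCLikeNormedField]
      exact WithTop.coe_le_coe.2 (le_top : (2 : ℕ∞) ≤ ⊤))
  rw [h3.fderiv]
  refine Prod.ext h.self_of_nhds (funext fun a => ?_)
  have h4 := congrArg (fun L : Euc n →L[ℝ] Euc n => L (z.2 a))
    (EventuallyEq.fderiv_eq (𝕜 := ℝ) (f₁ := fun y => fderiv ℝ φ y (ξ y)) (f := fun y => ξ' (φ y)) h)
  rw [fderiv_clm_apply hdd hξ] at h4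
  change _ = fderiv ℝ ξ' (φ z.1) (fderiv ℝ φ z.1 (z.2 a))
  have h5 : fderiv ℝ (fun y => ξ' (φ y)) z.1 = (fderiv ℝ ξ' (φ z.1)).comp (fderiv ℝ φ z.1) :=
    fderiv_comp z.1 hξ' hd
  rw [h5, ContinuousLinearMap.comp_apply] at h4
  rw [← h4]
  simp [frameLift, hsymm.eq (ξ z.1) (z.2 a)]

variable (O) in
/-- A local form of a vector field of the orbifold in the chart `U i`. -/
def localForm (X : O.Vect) (i : O.ι) : Euc n → Euc n := (X.2 i).choose

theorem isLocalForm_localForm (X : O.Vect) (i : O.ι) : O.IsLocalForm X.1 i (O.localForm X i) :=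
  (X.2 i).choose_spec

theorem contDiffAt_localForm (X : O.Vect) {x : Euc n} (hx : x ∈ O.U i) :
    ContDiffAt ℝ ∞ (O.localForm X i) x :=
  (isLocalForm_localForm X i).1.contDiffAt ((O.isOpen_U i).mem_nhds hx)

theorem Change.fderiv_ambient [T2Space V] (h : O.Change i j φ W W') (X : O.Vect) (G : O.ResFun)
    (hz : z ∈ O.frames i) (hW : z.1 ∈ W) :
    fderiv ℝ (ambient G i) z (frameLift (O.localForm X i) z) =
      fderiv ℝ (ambient G j) (frameLift φ z) (frameLift (O.localForm X j) (frameLift φ z)) := by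
  have hd := frames_subset_frameDomain hz
  have h1 : ambient G i =ᶠ[𝓝 z] ambient G j ∘ frameLift φ := by
    filter_upwards [(O.isOpen_frameDomain i).mem_nhds hd,
      continuousAt_fst.eventually_mem (h.isOpen.mem_nhds hW)] with u hu huW
    exact (h.ambient_frameLift G hu huW).symm
  have h2 : ∀ᶠ y in 𝓝 z.1, fderiv ℝ φ y (O.localForm X i y) = O.localForm X j (φ y) := by
    filter_upwards [h.isOpen.mem_nhds hW] with y hy
    exact h.fderiv_localForm (isLocalForm_localForm X i) (isLocalForm_localForm X j) hy
  rw [h1.fderiv_eq, fderiv_comp z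
    ((contDiffAt_ambient G (h.frameLift_mem_frameDomain hd hW)).differentiableAt (by simp))
    ((contDiffAt_frameLift (h.contDiffAt hW)).differentiableAt (by simp)),
    ContinuousLinearMap.comp_apply, fderiv_frameLift_frameLift (h.contDiffAt hW)
      ((contDiffAt_localForm X hz.1).differentiableAt (by simp))
      ((contDiffAt_localForm X (h.apply_mem hW)).differentiableAt (by simp)) h2]

section T2

variable [T2Space V]

/-- The derivative of a function of the resolution along the natural lift
`(x, A) ↦ (ξ(x), dξ_x A)` of a vector field. -/
def liftApply (X : O.Vect) (G : O.ResFun) : O.ResFun :=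
  ⟨Quot.lift (fun a => fderiv ℝ (ambient G a.1) a.2.1 (frameLift (O.localForm X a.1) a.2.1)) (by
    rintro ⟨i, z, hz⟩ ⟨j, w, hw⟩ ⟨φ, W, W', h, hW, h1, h2⟩
    obtain rfl : frameLift φ z = w := Prod.ext h1 (funext h2)
    exact Change.fderiv_ambient h X G hz hW), fun i => by
    refine ⟨fun z => fderiv ℝ (ambient G i) z (frameLift (O.localForm X i) z), fun z hz => ?_,
      fun _ => rfl⟩
    exact (((contDiffAt_ambient G (frames_subset_frameDomain hz)).fderiv_right (m := ∞)
      (by simp)).clm_apply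
      (contDiffAt_frameLift (contDiffAt_localForm X hz.1))).contDiffWithinAt⟩

theorem liftApply_framePt (X : O.Vect) (G : O.ResFun) (hz : z ∈ O.frames i) :
    liftApply X G (framePt i z hz) =
      fderiv ℝ (ambient G i) z (frameLift (O.localForm X i) z) := rfl

theorem liftApply_pullback (X : O.Vect) (f : O.Fun) :
    liftApply X (O.pullback f).1 = (O.pullback (X.1 f)).1 := by
  ext ρ
  obtain ⟨i, z, hz, rfl⟩ := exists_framePt_eq ρ
  rw [liftApply_framePt, fderiv_ambient_pullback f hz]
  exact ((isLocalForm_localForm X i).2 f z.1 hz.1).symm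

/-- The natural lift of a vector field of the orbifold to the resolution. -/
def lift (X : O.Vect) : Foliated.VF O.resSmooth := Derivation.mk'
  { toFun := liftApply X
    map_add' := fun G G' => by
      ext ρ
      obtain ⟨i, z, hz, rfl⟩ := exists_framePt_eq ρ
      have hd := frames_subset_frameDomain hz
      have h : ambient (G + G' : O.ResFun) i = fun u => ambient G i u + ambient G' i u := by
        funext u
        simp only [ambient, onFrames]
        split_ifs <;> simp
      rw [SmoothFun.add_apply, liftApply_framePt, liftApply_framePt, liftApply_framePt, h,
        fderiv_fun_add ((contDiffAt_ambient G hd).differentiableAt (by simp))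
          ((contDiffAt_ambient G' hd).differentiableAt (by simp))]
      rfl
    map_smul' := fun r G => by
      ext ρ
      obtain ⟨i, z, hz, rfl⟩ := exists_framePt_eq ρ
      have hd := frames_subset_frameDomain hz
      have h : ambient (r • G : O.ResFun) i = fun u => r * ambient G i u := by
        funext u
        simp only [ambient, onFrames]
        split_ifs
        · rfl
        · simp
      change _ = r * liftApply X G _
      rw [liftApply_framePt, liftApply_framePt, h,
        fderiv_const_mul ((contDiffAt_ambient G hd).differentiableAt (by simp))]
      rfl }
  fun G G' => by
    ext ρ
    obtain ⟨i, z, hz, rfl⟩ := exists_framePt_eq ρ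
    have hd := frames_subset_frameDomain hz
    have h : ambient (G * G' : O.ResFun) i = fun u => ambient G i u * ambient G' i u := by
      funext u
      simp only [ambient, onFrames]
      split_ifs <;> simp
    change liftApply X (G * G') _ = G _ * liftApply X G' _ + G' _ * liftApply X G _
    rw [liftApply_framePt, liftApply_framePt, liftApply_framePt, h,
        fderiv_fun_mul ((contDiffAt_ambient G hd).differentiableAt (by simp))
          ((contDiffAt_ambient G' hd).differentiableAt (by simp)),
        ambient_eq_onFrames _ hz, ambient_eq_onFrames _ hz, onFrames_apply _ hz,
        onFrames_apply _ hz]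
    simp

theorem lift_pullback (X : O.Vect) (f : O.Fun) :
    lift X (O.pullback f).1 = (O.pullback (X.1 f)).1 := liftApply_pullback X f

theorem lift_mem_adapted (X : O.Vect) : lift X ∈ Foliated.adapted O.resSmooth O.fol :=
  mem_adapted_of_forall fun F hF => by
    obtain ⟨f, hf⟩ := pullback_surjective (⟨F, hF⟩ : O.FolFun)
    rw [show F = (O.pullback f).1 from (congrArg Subtype.val hf).symm, lift_pullback]
    exact (O.pullback _).2

theorem exists_folVect_of_vect (X : O.Vect) : ∃ Z : O.FolVect, ∀ f,
    Foliated.Vect.act Z (O.pullback f) = O.pullback (X.1 f) :=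
  ⟨Submodule.Quotient.mk ⟨lift X, lift_mem_adapted X⟩, fun f => Subtype.ext (lift_pullback X f)⟩

end T2

/-! ### Gradient fields -/

/-- A family of vector fields on the charts that is compatible with the changes of charts is a
vector field of the orbifold. -/
theorem exists_vect_of_compatible {ξ : O.ι → Euc n → Euc n}
    (hξ : ∀ i, ContDiffOn ℝ ∞ (ξ i) (O.U i))
    (hc : ∀ {i j φ W W'}, O.Change i j φ W W' → ∀ x ∈ W, fderiv ℝ φ x (ξ i x) = ξ j (φ x)) :
    ∃ X : O.Vect, ∀ i, O.IsLocalForm X.1 i (ξ i) := by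
  choose c x hx hcx using O.cover
  set F : O.Fun → V → ℝ := fun f v => fderiv ℝ (fun y => f (O.q (c v) y)) (x v) (ξ (c v) (x v))
    with hF
  have hFq : ∀ f i, ∀ y ∈ O.U i, F f (O.q i y) = fderiv ℝ (fun y => f (O.q i y)) y (ξ i y) := by
    intro f i y hy
    obtain ⟨φ, W, W', hφ, hyW, he⟩ := exists_change_apply_eq hy (hx (O.q i y)) (hcx _).symm
    rw [hφ.fderiv_comp_q f hyW, hc hφ y hyW, he]
  have hsm : ∀ f, O.IsSmooth (F f) := fun f => O.isSmooth_of_forall fun i => by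
    refine ContDiffOn.congr (f := fun y => fderiv ℝ (fun y => f (O.q i y)) y (ξ i y)) ?_ (hFq f i)
    exact ((f.2.contDiffOn i).fderiv_of_isOpen (m := ∞) (O.isOpen_U i) (by simp)).clm_apply (hξ i)
  refine ⟨⟨Derivation.mk'
    { toFun := fun f => ⟨F f, hsm f⟩
      map_add' := fun f g => ?_
      map_smul' := fun r f => ?_ } fun f g => ?_, fun i => ⟨ξ i, hξ i, fun f y hy => hFq f i y hy⟩⟩,
    fun i => ⟨hξ i, fun f y hy => hFq f i y hy⟩⟩
  · ext v
    change fderiv ℝ (fun y => f (O.q (c v) y) + g (O.q (c v) y)) (x v) _ = F f v + F g v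
    rw [fderiv_fun_add (differentiableAt_fun f (hx v)) (differentiableAt_fun g (hx v))]
    rfl
  · ext v
    change fderiv ℝ (fun y => r * f (O.q (c v) y)) (x v) _ = r * F f v
    rw [fderiv_const_mul (differentiableAt_fun f (hx v))]
    rfl
  · ext v
    change fderiv ℝ (fun y => f (O.q (c v) y) * g (O.q (c v) y)) (x v) _ =
      f v * F g v + g v * F f v
    rw [fderiv_fun_mul (differentiableAt_fun f (hx v)) (differentiableAt_fun g (hx v))]
    simp only [hF, hcx, add_apply, smul_apply, smul_eq_mul]

/-- The gradient of `f` in the chart `U i`. -/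
def gradField (f : O.Fun) (i : O.ι) (x : Euc n) : Euc n :=
  ∑ a, fderiv ℝ (fun y => f (O.q i y)) x ((O.frameSection i x).2 a) • (O.frameSection i x).2 a

/-- The vector `gradField f i x` represents the differential of `f` with respect to the metric. -/
theorem g_gradField (f : O.Fun) {x : Euc n} (hx : x ∈ O.U i) (v : Euc n) :
    O.g i x (gradField f i x) v = fderiv ℝ (fun y => f (O.q i y)) x v := by
  have ho : FormOrthonormal (O.g i x) (O.frameSection i x).2 := (frameSection_mem_frames hx).2
  conv_rhs => rw [← ho.sum_eq (by simp) v]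
  rw [gradField, map_sum, sum_apply, map_sum]
  refine Finset.sum_congr rfl fun a _ => ?_
  rw [map_smul, map_smul, smul_apply, smul_eq_mul, smul_eq_mul, O.g_symm i x hx v, mul_comm]

theorem eq_of_forall_g_eq {x : Euc n} (hx : x ∈ O.U i) {v w : Euc n}
    (h : ∀ u, O.g i x v u = O.g i x w u) : v = w := by
  by_contra hne
  have h1 := O.g_pos i x hx (v - w) (sub_ne_zero.2 hne)
  rw [map_sub (O.g i x), sub_apply, h, sub_self] at h1
  exact lt_irrefl _ h1

theorem contDiffOn_gradField (f : O.Fun) (i : O.ι) :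
    ContDiffOn ℝ ∞ (gradField f i) (O.U i) := by
  refine ContDiffOn.sum fun a _ => ?_
  have hs : ContDiffOn ℝ ∞ (fun x => (O.frameSection i x).2 a) (O.U i) :=
    contDiffOn_pi.1 (contDiff_snd.comp_contDiffOn contDiffOn_frameSection) a
  exact (((f.2.contDiffOn i).fderiv_of_isOpen (m := ∞) (O.isOpen_U i) (by simp)).clm_apply hs).smul
    hs

theorem Change.fderiv_gradField (h : O.Change i j φ W W') (f : O.Fun) {x : Euc n} (hx : x ∈ W) :
    fderiv ℝ φ x (gradField f i x) = gradField f j (φ x) := by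
  refine eq_of_forall_g_eq (h.apply_mem hx) fun u => ?_
  obtain ⟨v, rfl⟩ := h.fderiv_surjective hx u
  rw [h.isometry.metric x hx, g_gradField f (h.subset hx), g_gradField f (h.apply_mem hx),
    h.fderiv_comp_q f hx]

theorem exists_vect_gradField (f : O.Fun) :
    ∃ X : O.Vect, ∀ i, O.IsLocalForm X.1 i (gradField f i) :=
  exists_vect_of_compatible (contDiffOn_gradField f) fun h _ hx => h.fderiv_gradField f hx

/-- At a regular point every vector is the value of a gradient field. -/
theorem IsRegular.exists_gradField_eq [T2Space V] {x : Euc n} (hreg : O.IsRegular i x)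
    (hx : x ∈ O.U i) (v : Euc n) : ∃ f : O.Fun, gradField f i x = v := by
  obtain ⟨f, hf⟩ := hreg.exists_fun_eventuallyEq hx (O.g i x v).contDiff
  refine ⟨f, eq_of_forall_g_eq hx fun u => ?_⟩
  rw [g_gradField f hx, hf.fderiv_eq, ContinuousLinearMap.fderiv]

/-! ### One-forms -/

/-- Components of a one-form of the orbifold in the chart `U i`, chosen among those that the
definition of a one-form provides. -/
def coForm (α : O.Form) (i : O.ι) : Euc n → Euc n →L[ℝ] ℝ := (α.local_form i).choose

theorem contDiffOn_coForm (α : O.Form) (i : O.ι) : ContDiffOn ℝ ∞ (coForm α i) (O.U i) :=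
  (α.local_form i).choose_spec.1

theorem coForm_apply (α : O.Form) {X : O.Vect} {ξ : Euc n → Euc n} (hξ : O.IsLocalForm X.1 i ξ)
    {x : Euc n} (hx : x ∈ O.U i) : coForm α i x (ξ x) = α.toFun X (O.q i x) :=
  ((α.local_form i).choose_spec.2 X ξ hξ x hx).symm

theorem fderiv_clm_apply_of_fst_eq_zero {c : Euc n → Euc n →L[ℝ] ℝ} {η : FrameSpace n → Euc n}
    (hc : DifferentiableAt ℝ c z.1) (hη : DifferentiableAt ℝ η z) {v : FrameSpace n}
    (hv : v.1 = 0) : fderiv ℝ (fun u : FrameSpace n => c u.1 (η u)) z v =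
      c z.1 (fderiv ℝ η z v) := by
  have h1 : HasFDerivAt (fun u : FrameSpace n => c u.1)
      ((fderiv ℝ c z.1).comp (ContinuousLinearMap.fst ℝ _ _)) z :=
    hc.hasFDerivAt.comp z hasFDerivAt_fst
  rw [(h1.clm_apply hη.hasFDerivAt).fderiv]
  simp [hv]

section T2

variable [T2Space V]

/-- The pairing of a one-form with the projection of a vector field of the resolution does not
depend on the chart. -/
theorem Change.coForm_baseForm (h : O.Change i j φ W W') (α : O.Form)
    (Z : Foliated.VF O.resSmooth) (hz : z ∈ O.frames i) (hW : z.1 ∈ W) :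
    coForm α i z.1 (baseForm Z i z) =
      coForm α j (φ z.1) (baseForm Z j (frameLift φ z)) := by
  -- At a regular point, the vector in question is the value of a gradient field.
  have hregular : ∀ u ∈ O.frames i, u.1 ∈ W → O.IsRegular i u.1 →
      coForm α i u.1 (baseForm Z i u) = coForm α j (φ u.1) (baseForm Z j (frameLift φ u)) := by
    intro u hu huW hreg
    obtain ⟨f, hf⟩ := hreg.exists_gradField_eq (h.subset huW) (baseForm Z i u)
    obtain ⟨X, hX⟩ := exists_vect_gradField f
    have h1 : fderiv ℝ φ u.1 (baseForm Z i u) = baseForm Z j (frameLift φ u) := by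
      refine hreg.fderiv_apply_eq h huW fun f => ?_
      rw [← (isBaseForm_baseForm Z i).2 f u hu, ← h.onFrames_frameLift _ hu huW]
      exact (isBaseForm_baseForm Z j).2 f _ (h.frameLift_mem hu huW)
    rw [← h1, ← hf, coForm_apply α (hX i) (h.subset huW), h.fderiv_gradField f huW,
      coForm_apply α (hX j) (h.apply_mem huW), h.comp_eq _ huW]
  -- In general, the point is moved to nearby regular points, along a local section of the frames.
  have hdom : ∀ x ∈ W, ((x, z.2) : FrameSpace n) ∈ O.frameDomain i := fun x hx =>
    ⟨h.subset hx, (frames_subset_frameDomain hz).2⟩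
  set σ : Euc n → FrameSpace n := fun x => O.retract i (x, z.2) with hσ
  have hσf : ∀ x ∈ W, σ x ∈ O.frames i := fun x hx => retract_mem_frames (hdom x hx)
  have hσc : ContinuousOn σ W := contDiffOn_retract.continuousOn.comp
    (continuous_id.prodMk continuous_const).continuousOn hdom
  have hσz : σ z.1 = z := retract_eq_self hz
  have hlift : ContinuousOn (fun x => frameLift φ (σ x)) W := fun x hx =>
    ContinuousAt.comp_continuousWithinAt (g := frameLift φ)
      (contDiffAt_frameLift (h.contDiffAt (x := (σ x).1) hx)).continuousAt (hσc x hx)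
  have hc1 : ContinuousAt (fun x => coForm α i x (baseForm Z i (σ x))) z.1 :=
    (((contDiffOn_coForm α i).continuousOn.mono h.subset).clm_apply
      ((isBaseForm_baseForm Z i).1.continuousOn.comp hσc hσf)).continuousAt (h.isOpen.mem_nhds hW)
  have hc2 : ContinuousAt (fun x => coForm α j (φ x) (baseForm Z j (frameLift φ (σ x)))) z.1 :=
    (((contDiffOn_coForm α j).continuousOn.comp h.isometry.contDiffOn.continuousOn
      fun x hx => h.apply_mem hx).clm_apply
      ((isBaseForm_baseForm Z j).1.continuousOn.comp hlift
        fun x hx => h.frameLift_mem (hσf x hx) hx)).continuousAt (h.isOpen.mem_nhds hW)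
  by_contra hne
  rw [← hσz] at hne
  obtain ⟨y, hreg, hyW, hy⟩ := ((frequently_isRegular (h.subset hW)).and_eventually
    ((h.isOpen.eventually_mem hW).and
      ((hc1.prodMk hc2).eventually_mem ((isOpen_ne_fun continuous_fst continuous_snd).mem_nhds
        hne)))).exists
  exact hy (hregular (σ y) (hσf y hyW) hyW hreg)

/-- The value of the pullback of a one-form of the orbifold on a vector field of the resolution. -/
def formApply (α : O.Form) (Z : Foliated.VF O.resSmooth) : O.ResFun :=
  ⟨Quot.lift (fun a => coForm α a.1 a.2.1.1 (baseForm Z a.1 a.2.1)) (by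
    rintro ⟨i, z, hz⟩ ⟨j, w, hw⟩ ⟨φ, W, W', h, hW, h1, h2⟩
    obtain rfl : frameLift φ z = w := Prod.ext h1 (funext h2)
    exact Change.coForm_baseForm h α Z hz hW), fun i =>
    ⟨fun z => coForm α i z.1 (baseForm Z i z),
      ((contDiffOn_coForm α i).comp contDiff_fst.contDiffOn fun _ hz => hz.1).clm_apply
        (isBaseForm_baseForm Z i).1, fun _ => rfl⟩⟩

theorem formApply_framePt (α : O.Form) (Z : Foliated.VF O.resSmooth) (hz : z ∈ O.frames i) :
    formApply α Z (framePt i z hz) = coForm α i z.1 (baseForm Z i z) := rfl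

theorem baseForm_add (Z Z' : Foliated.VF O.resSmooth) (hz : z ∈ O.frames i) :
    baseForm (Z + Z') i z = baseForm Z i z + baseForm Z' i z :=
  (isBaseForm_baseForm _ i).eq_of_forall (η' := fun z => baseForm Z i z + baseForm Z' i z)
    ((isBaseForm_baseForm Z i).1.continuousOn.add (isBaseForm_baseForm Z' i).1.continuousOn)
    (fun f u hu => by
      rw [map_add, ← (isBaseForm_baseForm Z i).2 f u hu, ← (isBaseForm_baseForm Z' i).2 f u hu,
        onFrames_apply _ hu, onFrames_apply _ hu, onFrames_apply _ hu]
      rfl) hz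

theorem baseForm_smul (G : O.ResFun) (Z : Foliated.VF O.resSmooth) (hz : z ∈ O.frames i) :
    baseForm (G • Z) i z = onFrames G i z • baseForm Z i z :=
  (isBaseForm_baseForm _ i).eq_of_forall (η' := fun z => onFrames G i z • baseForm Z i z)
    ((contDiffOn_onFrames G i).continuousOn.smul (isBaseForm_baseForm Z i).1.continuousOn)
    (fun f u hu => by
      rw [map_smul, ← (isBaseForm_baseForm Z i).2 f u hu,
        onFrames_apply _ hu, onFrames_apply _ hu, onFrames_apply _ hu]
      rfl) hz

theorem differentiableAt_baseForm_retract (Z : Foliated.VF O.resSmooth) (hz : z ∈ O.frames i) :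
    DifferentiableAt ℝ (fun u => baseForm Z i (O.retract i u)) z :=
  (((isBaseForm_baseForm Z i).1.comp contDiffOn_retract fun _ hu =>
    retract_mem_frames hu).contDiffAt ((O.isOpen_frameDomain i).mem_nhds
      (frames_subset_frameDomain hz))).differentiableAt (by simp)

/-- The bracket with a vector field `Y` tangent to the leaves is the derivative along `Y` of the
projection to the orbifold. -/
theorem baseForm_lie {Y : Foliated.VF O.resSmooth} (hY : Y ∈ Foliated.tangent O.resSmooth O.fol)
    (Z : Foliated.VF O.resSmooth) (hz : z ∈ O.frames i) :
    baseForm ⁅Y, Z⁆ i z =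
      fderiv ℝ (fun u => baseForm Z i (O.retract i u)) z (frameForm Y i z) := by
  have hsm : ContDiffOn ℝ ∞ (fun u => baseForm Z i (O.retract i u)) (O.frameDomain i) :=
    (isBaseForm_baseForm Z i).1.comp contDiffOn_retract fun _ hu => retract_mem_frames hu
  refine (isBaseForm_baseForm ⁅Y, Z⁆ i).eq_of_forall
    (η' := fun z => fderiv ℝ (fun u => baseForm Z i (O.retract i u)) z (frameForm Y i z)) ?_ ?_ hz
  · exact ((hsm.fderiv_of_isOpen (m := ∞) (O.isOpen_frameDomain i) (by simp)).continuousOn.mono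
      frames_subset_frameDomain).clm_apply (isFrameForm_frameForm Y i).1.continuousOn
  · intro f u hu
    have hd := frames_subset_frameDomain hu
    have h1 : ⁅Y, Z⁆ (O.pullback f).1 = Y (Z (O.pullback f).1) := by
      rw [Derivation.commutator_apply, mem_tangent_iff.1 hY, map_zero, sub_zero]
    have h2 : ambient (Z (O.pullback f).1) i =ᶠ[𝓝 u] fun u =>
        fderiv ℝ (fun y => f (O.q i y)) u.1 (baseForm Z i (O.retract i u)) := by
      filter_upwards [(O.isOpen_frameDomain i).mem_nhds hd] with v hv
      exact (isBaseForm_baseForm Z i).2 f _ (retract_mem_frames hv)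
    rw [h1, (isFrameForm_frameForm Y i).2 _ u hu, h2.fderiv_eq]
    exact fderiv_clm_apply_of_fst_eq_zero
      (((contDiffAt_fun f hu.1).fderiv_right (m := ∞) (by simp)).differentiableAt (by simp))
      (differentiableAt_baseForm_retract Z hu) (baseForm_eq_zero (mem_tangent_iff.1 hY) hu)

theorem formApply_eq_zero (α : O.Form) {Y : Foliated.VF O.resSmooth}
    (hY : Y ∈ Foliated.tangent O.resSmooth O.fol) : formApply α Y = 0 := by
  ext ρ
  obtain ⟨i, z, hz, rfl⟩ := exists_framePt_eq ρ
  rw [formApply_framePt, baseForm_eq_zero (mem_tangent_iff.1 hY) hz, map_zero]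
  rfl

/-- The pullback of a one-form is invariant under the fields tangent to the leaves. -/
theorem apply_formApply (α : O.Form) {Y : Foliated.VF O.resSmooth}
    (hY : Y ∈ Foliated.tangent O.resSmooth O.fol) (Z : Foliated.VF O.resSmooth) :
    Y (formApply α Z) = formApply α ⁅Y, Z⁆ := by
  ext ρ
  obtain ⟨i, z, hz, rfl⟩ := exists_framePt_eq ρ
  have hd := frames_subset_frameDomain hz
  have h2 : ambient (formApply α Z) i =ᶠ[𝓝 z] fun u =>
      coForm α i u.1 (baseForm Z i (O.retract i u)) := by
    filter_upwards [(O.isOpen_frameDomain i).mem_nhds hd] with v hv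
    exact onFrames_apply _ (retract_mem_frames hv)
  rw [formApply_framePt, baseForm_lie hY Z hz]
  refine (onFrames_apply (Y (formApply α Z)).1 hz).symm.trans ?_
  rw [(isFrameForm_frameForm Y i).2 _ z hz, h2.fderiv_eq]
  exact fderiv_clm_apply_of_fst_eq_zero
    (((contDiffOn_coForm α i).contDiffAt ((O.isOpen_U i).mem_nhds hz.1)).differentiableAt (by simp))
    (differentiableAt_baseForm_retract Z hz) (baseForm_eq_zero (mem_tangent_iff.1 hY) hz)

theorem formApply_eq_pullback (α : O.Form) {Z : Foliated.VF O.resSmooth} {X : O.Vect}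
    (h : ∀ f, Z (O.pullback f).1 = (O.pullback (X.1 f)).1) :
    formApply α Z = (O.pullback (α.toFun X)).1 := by
  ext ρ
  obtain ⟨i, z, hz, rfl⟩ := exists_framePt_eq ρ
  have hX := isLocalForm_localForm X i
  have h1 : baseForm Z i z = O.localForm X i z.1 :=
    (isBaseForm_baseForm Z i).eq_of_forall (η' := fun z => O.localForm X i z.1)
      (hX.1.continuousOn.comp continuous_fst.continuousOn fun _ hu => hu.1) (fun f u hu => by
        rw [h, onFrames_pullback _ hu]
        exact hX.2 f _ hu.1) hz
  rw [formApply_framePt, h1, coForm_apply α hX hz.1]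
  rfl

/-- The pullback of one-forms. -/
def pullbackForm (α : O.Form) : O.FolForm where
  toFun :=
    { toFun := formApply α
      map_add' := fun Z Z' => by
        ext ρ
        obtain ⟨i, z, hz, rfl⟩ := exists_framePt_eq ρ
        rw [SmoothFun.add_apply, formApply_framePt, formApply_framePt, formApply_framePt,
          baseForm_add Z Z' hz, map_add]
      map_smul' := fun G Z => by
        ext ρ
        obtain ⟨i, z, hz, rfl⟩ := exists_framePt_eq ρ
        rw [RingHom.id_apply, smul_eq_mul, SmoothFun.mul_apply, formApply_framePt,
          formApply_framePt, baseForm_smul G Z hz, map_smul, onFrames_apply _ hz, smul_eq_mul] }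
  contract _ hY := formApply_eq_zero α hY
  contract_d Y hY Z := by
    change Y (formApply α Z) - Z (formApply α Y) - formApply α ⁅Y, Z⁆ = 0
    rw [apply_formApply α hY, formApply_eq_zero α hY, map_zero, sub_zero, sub_self]
  map_adapted Z hZ := by
    obtain ⟨X, hX⟩ := exists_vect_of_folVect (Submodule.Quotient.mk ⟨Z, hZ⟩ : O.FolVect)
    have h := formApply_eq_pullback α (Z := Z) (X := X) fun f => congrArg Subtype.val (hX f)
    change formApply α Z ∈ _
    rw [h]
    exact (O.pullback _).2

theorem pullbackForm_eval (α : O.Form) {Z : O.FolVect} {X : O.Vect}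
    (h : ∀ f, Foliated.Vect.act Z (O.pullback f) = O.pullback (X.1 f)) :
    (pullbackForm α).eval Z = O.pullback (α.toFun X) := by
  obtain ⟨Z, rfl⟩ := Submodule.Quotient.mk_surjective _ Z
  exact Subtype.ext (formApply_eq_pullback α fun f => congrArg Subtype.val (h f))

end T2

end RiemannianOrbifold

/-- Transport of a torsion-free connection along an isomorphism `e` of modules of vector fields over
a surjection `p` of algebras of functions. -/
def TorsionFreeConnection.transport {A L A' L' : Type*} [CommRing A] [Algebra ℝ A] [AddCommGroup L]
    [Module ℝ L] [Module A L] [Bracket L L] [CommRing A'] [Algebra ℝ A'] [AddCommGroup L']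
    [Module ℝ L'] [Module A' L'] [Bracket L' L'] {ρ : L → A → A} {ρ' : L' → A' → A'}
    (e : L ≃ₗ[ℝ] L') (p : A → A') (hp : Function.Surjective p)
    (hsmul : ∀ f X, e (f • X) = p f • e X) (hlie : ∀ X Y, e ⁅X, Y⁆ = ⁅e X, e Y⁆)
    (hρ : ∀ X f, ρ' (e X) (p f) = p (ρ X f)) (C : TorsionFreeConnection A L ρ) :
    TorsionFreeConnection A' L' ρ' where
  toFun := (C.toFun.compl₁₂ e.symm.toLinearMap e.symm.toLinearMap).compr₂ e.toLinearMap
  smul_left F X Y := by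
    obtain ⟨f, rfl⟩ := hp F
    obtain ⟨X, rfl⟩ := e.surjective X
    simp [← hsmul, C.smul_left]
  leibniz F X Y := by
    obtain ⟨f, rfl⟩ := hp F
    obtain ⟨X, rfl⟩ := e.surjective X
    obtain ⟨Y, rfl⟩ := e.surjective Y
    simp [← hsmul, hρ, C.leibniz]
  torsion_free X Y := by
    obtain ⟨X, rfl⟩ := e.surjective X
    obtain ⟨Y, rfl⟩ := e.surjective Y
    simp [← map_sub, C.torsion_free, hlie]

namespace RiemannianOrbifold

variable {n : ℕ} {V : Type*} [TopologicalSpace V] {O : RiemannianOrbifold n V}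

/-! ### The pullback of vector fields and connections -/

theorem act_lie (Z Z' : O.FolVect) (F : O.FolFun) : Foliated.Vect.act ⁅Z, Z'⁆ F =
    Foliated.Vect.act Z (Foliated.Vect.act Z' F) -
      Foliated.Vect.act Z' (Foliated.Vect.act Z F) := by
  obtain ⟨Z, rfl⟩ := Submodule.Quotient.mk_surjective _ Z
  obtain ⟨Z', rfl⟩ := Submodule.Quotient.mk_surjective _ Z'
  exact Subtype.ext (Derivation.commutator_apply (D1 := Z.1) (D2 := Z'.1) F.1)

variable [T2Space V]

/-- The foliated vector field that acts as `X` on the pullbacks of functions. -/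
def pullbackVectFun (X : O.Vect) : O.FolVect := (exists_folVect_of_vect X).choose

theorem act_pullbackVectFun (X : O.Vect) (f : O.Fun) :
    Foliated.Vect.act (pullbackVectFun X) (O.pullback f) = O.pullback (X.1 f) :=
  (exists_folVect_of_vect X).choose_spec f

theorem pullbackVectFun_eq_iff {X : O.Vect} {Z : O.FolVect} : pullbackVectFun X = Z ↔
    ∀ f : O.Fun, Foliated.Vect.act Z (O.pullback f) = O.pullback (X.1 f) :=
  ⟨fun h f => h ▸ act_pullbackVectFun X f,
    fun h => act_injective fun f => (act_pullbackVectFun X f).trans (h f).symm⟩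

theorem pullbackVectFun_smul (f : O.Fun) (X : O.Vect) :
    pullbackVectFun (f • X) = O.pullback f • pullbackVectFun X :=
  pullbackVectFun_eq_iff.2 fun g => by
    rw [map_smul, Derivation.smul_apply, act_pullbackVectFun]
    rfl

variable (O) in
/-- The pullback of vector fields, an isomorphism onto the foliated vector fields. -/
def pullbackVect : O.Vect ≃ₗ[ℝ] O.FolVect :=
  LinearEquiv.ofBijective
    { toFun := pullbackVectFun
      map_add' := fun X Y => pullbackVectFun_eq_iff.2 fun f => by
        rw [map_add, Derivation.add_apply, act_pullbackVectFun, act_pullbackVectFun]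
        rfl
      map_smul' := fun r X => by
        have h := pullbackVectFun_smul (algebraMap ℝ O.Fun r) X
        rw [algebraMap_smul] at h
        rw [h]
        exact algebraMap_smul O.FolFun r (pullbackVectFun X) }
    ⟨fun X Y h => Subtype.ext (Derivation.ext fun f => pullback_injective (by
      rw [← act_pullbackVectFun, ← act_pullbackVectFun]
      exact congrArg (fun Z => Foliated.Vect.act Z (O.pullback f)) h)),
    fun Z => (exists_vect_of_folVect Z).imp fun _ hX => pullbackVectFun_eq_iff.2 hX⟩

theorem pullbackVect_eq_iff {X : O.Vect} {Z : O.FolVect} : O.pullbackVect X = Z ↔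
    ∀ f : O.Fun, Foliated.Vect.act Z (O.pullback f) = O.pullback (X.1 f) := pullbackVectFun_eq_iff

theorem act_pullbackVect (X : O.Vect) (f : O.Fun) :
    Foliated.Vect.act (O.pullbackVect X) (O.pullback f) = O.pullback (X.1 f) :=
  act_pullbackVectFun X f

theorem pullbackVect_smul (f : O.Fun) (X : O.Vect) :
    O.pullbackVect (f • X) = O.pullback f • O.pullbackVect X := pullbackVectFun_smul f X

theorem pullbackVect_lie (X Y : O.Vect) :
    O.pullbackVect ⁅X, Y⁆ = ⁅O.pullbackVect X, O.pullbackVect Y⁆ :=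
  pullbackVect_eq_iff.2 fun f => by
    rw [act_lie, act_pullbackVect, act_pullbackVect, act_pullbackVect, act_pullbackVect]
    rfl

theorem act_eq_pullback_symm (Z : O.FolVect) (f : O.Fun) :
    Foliated.Vect.act Z (O.pullback f) = O.pullback ((O.pullbackVect.symm Z).1 f) := by
  rw [← act_pullbackVect, LinearEquiv.apply_symm_apply]

/-- The pullback of torsion-free connections. -/
def pullbackConnection (C : O.Connection) : O.FolConnection :=
  C.transport O.pullbackVect O.pullback pullback_surjective pullbackVect_smul pullbackVect_lie
    act_pullbackVect

theorem pullbackConnection_toFun (C : O.Connection) (X Y : O.FolVect) :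
    (pullbackConnection C).toFun X Y =
      O.pullbackVect (C.toFun (O.pullbackVect.symm X) (O.pullbackVect.symm Y)) := rfl

theorem pullbackForm_eval_eq (α : O.Form) (Z : O.FolVect) :
    (pullbackForm α).eval Z = O.pullback (α.toFun (O.pullbackVect.symm Z)) :=
  pullbackForm_eval α (act_eq_pullback_symm Z)

theorem pullbackConnection_differsBy {C C' : O.Connection} {α : O.Form}
    (h : C.DiffersBy C' α.toFun) :
    (pullbackConnection C).DiffersBy (pullbackConnection C') (pullbackForm α).eval := fun X Y => by
  rw [pullbackConnection_toFun, pullbackConnection_toFun, ← map_sub, h, map_add, pullbackVect_smul,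
    pullbackVect_smul, LinearEquiv.apply_symm_apply, LinearEquiv.apply_symm_apply,
    pullbackForm_eval_eq, pullbackForm_eval_eq]

end RiemannianOrbifold

end

theorem mainTheorem4 {n : ℕ} {V : Type*} [TopologicalSpace V] [T2Space V]
    [SecondCountableTopology V] (O : RiemannianOrbifold n V) :
    ∃ pVect : O.Vect ≃ₗ[ℝ] O.FolVect,
      (∀ (X : O.Vect) (Z : O.FolVect), pVect X = Z ↔
        ∀ f : O.Fun, Foliated.Vect.act Z (O.pullback f) = O.pullback (X.1 f)) ∧
      (∀ (f : O.Fun) (X : O.Vect), pVect (f • X) = O.pullback f • pVect X) ∧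
      (∀ X Y : O.Vect, pVect ⁅X, Y⁆ = ⁅pVect X, pVect Y⁆) ∧
      ∃ pC : O.Connection → O.FolConnection,
        (∀ (C : O.Connection) (X Y : O.FolVect),
          (pC C).toFun X Y = pVect (C.toFun (pVect.symm X) (pVect.symm Y))) ∧
        (∀ C C' : O.Connection, RiemannianOrbifold.ProjEquiv C C' →
          Foliated.ProjEquiv (pC C) (pC C')) ∧
        ∃ pForm : O.Form → O.FolForm,
          (∀ (α : O.Form) (X : O.FolVect),
            (pForm α).eval X = O.pullback (α.toFun (pVect.symm X))) ∧
          ∀ (C C' : O.Connection) (α : O.Form), C.DiffersBy C' α.toFun →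
            (pC C).DiffersBy (pC C') (pForm α).eval := by
  refine ⟨O.pullbackVect, fun _ _ => RiemannianOrbifold.pullbackVect_eq_iff,
    RiemannianOrbifold.pullbackVect_smul, RiemannianOrbifold.pullbackVect_lie,
    RiemannianOrbifold.pullbackConnection, RiemannianOrbifold.pullbackConnection_toFun,
    fun _ _ ⟨α, h⟩ => ⟨RiemannianOrbifold.pullbackForm α,
      RiemannianOrbifold.pullbackConnection_differsBy h⟩,
    RiemannianOrbifold.pullbackForm, RiemannianOrbifold.pullbackForm_eval_eq,
    fun _ _ _ => RiemannianOrbifold.pullbackConnection_differsBy⟩
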